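/- Let $\mathbb{T}^2=\mathbb{R}^2/\mathbb{Z}^2$, $\alpha>0$, $\mathbf{u}_h\in W^{3,2}(\mathbb{T}^2;\mathbb{R}^2)$ weakly divergence free, $f\in W^{2,2}(\mathbb{T}^2)$, $b_0\in W^{3,2}(\mathbb{T}^2)$ and $\omega_0\in W^{2,2}(\mathbb{T}^2)$. Consider the $\alpha$-TQG system $$\partial_t b^\alpha+\mathbf{u}^\alpha\cdot\nabla b^\alpha=0,\qquad \partial_t\omega^\alpha+\mathbf{u}^\alpha\cdot\nabla(\omega^\alpha-b^\alpha)=-\mathbf{u}_h\cdot\nabla b^\alpha,$$ $$\mathbf{u}^\alpha=\nabla^\perp\psi^\alpha=(-\partial_y\psi^\alpha,\partial_x\psi^\alpha),\qquad \omega^\alpha=(\Delta-1)(1-\alpha\Delta)\psi^\alpha+f.$$ For $0<T<\infty$, $(b^\alpha,\omega^\alpha,T)$ is a local strong solution with initial condition $(b_0,\omega_0)$ if $b^\alpha\in C([0,T];W^{3,2}(\mathbb{T}^2))$, $\omega^\alpha\in C([0,T];W^{2,2}(\mathbb{T}^2))$ and, for all $t\in[0,T]$, $$b^\alpha(t)=b_0-\int_0^t\operatorname{div}(b^\alpha\mathbf{u}^\alpha)\,d\tau,\qquad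 \omega^\alpha(t)=\omega_0-\int_0^t\big[\operatorname{div}((\omega^\alpha-b^\alpha)\mathbf{u}^\alpha)+\operatorname{div}(b^\alpha\mathbf{u}_h)\big]\,d\tau .$$ $(b^\alpha,\omega^\alpha,T^\alpha_{\max})$ with $T^\alpha_{\max}\in(0,\infty]$ is a maximal solution if there is an increasing sequence of times $T_n\to T^\alpha_{\max}$ such that every $(b^\alpha,\omega^\alpha,T_n)$ is a local strong solution with initial condition $(b_0,\omega_0)$ and, if $T^\alpha_{\max}<\infty$, $\limsup_{n\to\infty}\big(\|b^\alpha(T_n)\|_{W^{3,2}}+\|\omega^\alpha(T_n)\|_{W^{2,2}}\big)^2=\infty$. Theorem. Let $(b^\alpha,\omega^\alpha,T^\alpha_{\max})$ be a maximal solution of the $\alpha$-TQG system. If $T^\alpha_{\max}<\infty$, then $$\int_0^{T^\alpha_{\max}}\|\nabla\mathbf{u}^\alpha(t)\|_{L^\infty(\mathbb{T}^2)}\,dt=\infty .$$ -/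

import Mathlib

open MeasureTheory Filter Topology
open scoped ENNReal

namespace TQG

/-- The flat torus `ℝ² / ℤ²`; the coordinates `0`, `1` are `x`, `y`. It carries Lebesgue measure. -/
abbrev Torus : Type := UnitAddTorus (Fin 2)

/-- Real-valued square integrable functions on the torus. -/
abbrev L2 : Type := Lp ℝ 2 (volume : Measure Torus)

/-- Smooth functions on the torus: the periodic lift to `ℝ²` is `C^∞`. -/
def IsTest (φ : Torus → ℝ) : Prop :=
  ContDiff ℝ ((⊤ : ℕ∞) : WithTop ℕ∞) (fun y : Fin 2 → ℝ => φ (fun i => (y i : UnitAddCircle)))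

/-- Classical partial derivative in the `j`-th coordinate (used on smooth functions only). -/
noncomputable def pderiv (j : Fin 2) (φ : Torus → ℝ) : Torus → ℝ :=
  fun x => deriv (fun s : ℝ => φ (x + Pi.single j (s : UnitAddCircle))) 0

/-- `∂^β = ∂_x^{β.1} ∂_y^{β.2}` on smooth functions. -/
noncomputable def mderiv (β : ℕ × ℕ) (φ : Torus → ℝ) : Torus → ℝ :=
  (pderiv 0)^[β.1] ((pderiv 1)^[β.2] φ)

/-- The Laplacian on smooth functions. -/
noncomputable def lap (φ : Torus → ℝ) : Torus → ℝ :=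
  fun x => mderiv (2, 0) φ x + mderiv (0, 2) φ x

/-- `(Δ - 1)(1 - α Δ)` on smooth functions. -/
noncomputable def ellipticOp (α : ℝ) (φ : Torus → ℝ) : Torus → ℝ :=
  fun x => lap (fun z => φ z - α * lap φ z) x - (φ x - α * lap φ x)

/-- `w` is the weak derivative `∂^β v`. -/
def IsWeakDeriv (β : ℕ × ℕ) (v w : Torus → ℝ) : Prop :=
  Integrable v ∧ Integrable w ∧
    ∀ φ : Torus → ℝ, IsTest φ →
      ∫ x, v x * mderiv β φ x = (-1) ^ (β.1 + β.2) * ∫ x, w x * φ x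

/-- `w` is the weak divergence of the vector field `g`. -/
def IsWeakDiv (g : Fin 2 → Torus → ℝ) (w : Torus → ℝ) : Prop :=
  (∀ i, Integrable (g i)) ∧ Integrable w ∧
    ∀ φ : Torus → ℝ, IsTest φ →
      ∫ x, (g 0 x * pderiv 0 φ x + g 1 x * pderiv 1 φ x) = - ∫ x, w x * φ x

/-- The norm `∑_{|β| ≤ k} ‖∂^β v‖_p` of `W^{k,p}`, with the value `∞` exactly outside `W^{k,p}`.
The infimum is over the weak derivatives of `v` (unique up to null sets when they exist,
and the infimum is `∞` when there are none). -/
noncomputable def sobolevENorm (k : ℕ) (p : ℝ≥0∞) (v : Torus → ℝ) : ℝ≥0∞ :=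
  ∑ m ∈ Finset.range (k + 1), ∑ β ∈ Finset.HasAntidiagonal.antidiagonal m,
    ⨅ (w : Torus → ℝ) (_ : IsWeakDeriv β v w), eLpNorm w p volume

/-- The norm of `𝓜 = W^{3,2} × W^{2,2}`. -/
noncomputable def normM (b ω : L2) : ℝ≥0∞ :=
  sobolevENorm 3 2 b + sobolevENorm 2 2 ω

/-- `‖∇u‖_∞`: the essential supremum of the Frobenius norm of the weak gradient of `u`. -/
noncomputable def gradSupENorm (u : Fin 2 → L2) : ℝ≥0∞ :=
  ⨅ (G : Fin 2 → Fin 2 → Torus → ℝ)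
    (_ : ∀ i, IsWeakDeriv (1, 0) (u i) (G i 0) ∧ IsWeakDeriv (0, 1) (u i) (G i 1)),
    eLpNorm (fun x => Real.sqrt (∑ i, ∑ j, G i j x ^ 2)) ∞ volume

/-- `v ∈ C([0,T]; W^{k,2})`. -/
def ContSobolev (k : ℕ) (v : ℝ → L2) (T : ℝ) : Prop :=
  ∀ t ∈ Set.Icc 0 T, sobolevENorm k 2 (v t) < ∞ ∧
    Tendsto (fun s => sobolevENorm k 2 ((v s - v t : L2) : Torus → ℝ))
      (𝓝[Set.Icc 0 T] t) (𝓝 0)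

/-- `u = ∇^⊥ ψ = (-∂_y ψ, ∂_x ψ)`, where `(Δ - 1)(1 - α Δ) ψ = ω - f` on the torus. -/
def IsVelocity (α : ℝ) (f ω : L2) (u : Fin 2 → L2) : Prop :=
  ∃ ψ : L2,
    (∀ φ : Torus → ℝ, IsTest φ → ∫ x, ψ x * ellipticOp α φ x = ∫ x, (ω x - f x) * φ x) ∧
    IsWeakDeriv (0, 1) ψ (fun x => - u 0 x) ∧
    IsWeakDeriv (1, 0) ψ (u 1)

/-- `(b, ω, T)`, with velocity `u`, is a local strong solution of the `α`-TQG system with data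
`uh`, `f` and initial condition `(b₀, ω₀)`. The time integrals are Bochner integrals in `L²`. -/
structure IsLocalSolution (α : ℝ) (f : L2) (uh : Fin 2 → L2) (b₀ ω₀ : L2)
    (b ω : ℝ → L2) (u : ℝ → Fin 2 → L2) (T : ℝ) : Prop where
  pos : 0 < T
  cont_b : ContSobolev 3 b T
  cont_ω : ContSobolev 2 ω T
  velocity : ∀ t ∈ Set.Icc 0 T, IsVelocity α f (ω t) (u t)
  eq_b : ∃ F : ℝ → L2,
    (∀ τ ∈ Set.Icc 0 T, IsWeakDiv (fun i x => b τ x * u τ i x) (F τ)) ∧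
    IntervalIntegrable F volume 0 T ∧
    ∀ t ∈ Set.Icc 0 T, b t = b₀ - ∫ τ in (0 : ℝ)..t, F τ
  eq_ω : ∃ G H : ℝ → L2,
    (∀ τ ∈ Set.Icc 0 T, IsWeakDiv (fun i x => (ω τ x - b τ x) * u τ i x) (G τ)) ∧
    (∀ τ ∈ Set.Icc 0 T, IsWeakDiv (fun i x => b τ x * uh i x) (H τ)) ∧
    IntervalIntegrable G volume 0 T ∧ IntervalIntegrable H volume 0 T ∧
    ∀ t ∈ Set.Icc 0 T, ω t = ω₀ - ∫ τ in (0 : ℝ)..t, (G τ + H τ)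

/-- `(b, ω, Tmax)`, with velocity `u`, is a maximal solution of the `α`-TQG system. Values of
`b`, `ω`, `u` at times outside `[0, Tmax)` play no role. -/
def IsMaximalSolution (α : ℝ) (f : L2) (uh : Fin 2 → L2) (b₀ ω₀ : L2)
    (b ω : ℝ → L2) (u : ℝ → Fin 2 → L2) (Tmax : EReal) : Prop :=
  0 < Tmax ∧
  ∃ T : ℕ → ℝ, Monotone T ∧ Tendsto (fun n => (T n : EReal)) atTop (𝓝 Tmax) ∧
    (∀ n, IsLocalSolution α f uh b₀ ω₀ b ω u (T n)) ∧
    (Tmax < ⊤ → limsup (fun n => normM (b (T n)) (ω (T n)) ^ 2) atTop = ∞)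

end TQG

namespace TQG

/-! The proof is by contradiction: if the integral of `‖∇u‖_∞` is finite, then the norms of `b` and
`ω` stay bounded up to `Tmax`. Three a priori bounds, each feeding the next, give this.

(1) `b` in W^{1,2} (`IsLocalSolution.buoyancy_bound`). For divergence free `u`, the growth of the
gradient energy of `b` is governed by `∫ ∂_j u_i ∂_i b ∂_j b`, which is at most `‖∇u‖_∞` times the
energy (`gradient_bound`). The logarithm of the energy therefore grows by at most `2 ∫ ‖∇u‖_∞`. This
is the only place where the blow-up quantity enters.

(2) `ω` in L² (`IsLocalSolution.vorticity_bound`). Since `α > 0`, the elliptic operator has order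
four, so `u` gains three derivatives over `ω` and is bounded in W^{3,2} by `‖ω‖ + ‖f‖`
(`IsVelocity.wSummable`). Transport of `ω` by `u` conserves the L² norm. The remaining terms `u ·
∇b` and `uh · ∇b`, tested with `ω`, are at most quadratic in `‖ω‖` once `b` is bounded in W^{1,2},
and Grönwall's lemma applies.

(3) Top order (`IsLocalSolution.top_order_bound`). By (2) the velocity is bounded in W^{3,2}. In
dimension two this makes the Fourier coefficients of `∇u` summable, so the energies of `b` in
W^{3,2} and of `ω` in W^{2,2} satisfy a closed linear differential inequality.

The estimates are made on Fourier coefficients. The real part of the trilinear form of `u · ∇` is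
antisymmetric in its two frequencies (`IsSolenoidal.pairing_swap`), so a weight `φ` enters only
through `φ(m) - φ(l)`; this replaces commutator estimates (`IsSolenoidal.energy_le`). The time
derivatives are only known in L², hence the top order weights are truncated at a level `N`,
estimated uniformly in `N`, and then `N` is sent to infinity (`wnorm_sq_le_of_truncated`). -/

/-! ### Calculus of absolutely continuous functions, Grönwall's lemma and energy identities in time
-/

/-- Lipschitz functions of absolutely continuous functions: the logarithm on `[1, ∞)`. -/
theorem absolutelyContinuous_log {Z : ℝ → ℝ} {a b : ℝ} (hZ : AbsolutelyContinuousOnInterval Z a b)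
    (h1 : ∀ t ∈ Set.uIcc a b, 1 ≤ Z t) :
    AbsolutelyContinuousOnInterval (fun t => Real.log (Z t)) a b := by
  rw [absolutelyContinuousOnInterval_iff] at hZ ⊢
  intro ε hε
  obtain ⟨δ, hδ, h⟩ := hZ ε hε
  refine ⟨δ, hδ, fun E hE hEδ => lt_of_le_of_lt (Finset.sum_le_sum fun i hi => ?_) (h E hE hEδ)⟩
  have key : ∀ x y : ℝ, 1 ≤ x → 1 ≤ y → Real.log x - Real.log y ≤ |x - y| := by
    intro x y hx hy
    rw [← Real.log_div (by positivity) (by positivity)]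
    have h2 := Real.log_le_sub_one_of_pos (show 0 < x / y by positivity)
    have h3 : x / y - 1 = (x - y) / y := by field_simp
    rw [h3] at h2
    refine h2.trans ((div_le_div_of_nonneg_right (le_abs_self _) (by positivity)).trans ?_)
    exact div_le_self (abs_nonneg _) hy
  have m1 := h1 _ (hE.1 i hi).1
  have m2 := h1 _ (hE.1 i hi).2
  rw [Real.dist_eq, Real.dist_eq, abs_sub_le_iff]
  exact ⟨key _ _ m1 m2, by rw [abs_sub_comm]; exact key _ _ m2 m1⟩

theorem absolutelyContinuous_primitive {F : ℝ → ℝ} {T c : ℝ}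
    (hF : IntervalIntegrable F volume 0 T) :
    AbsolutelyContinuousOnInterval (fun t => c + ∫ τ in (0 : ℝ)..t, F τ) 0 T := by
  have h := hF.absolutelyContinuousOnInterval_intervalIntegral (c := 0) (by simp)
  have hc : AbsolutelyContinuousOnInterval (fun _ : ℝ => c) 0 T :=
    contDiffOn_const.absolutelyContinuousOnInterval
  exact hc.add h

theorem ae_hasDerivAt_primitive {F : ℝ → ℝ} {T c : ℝ} (hF : IntervalIntegrable F volume 0 T) :
    ∀ᵐ x, x ∈ Set.uIcc 0 T → HasDerivAt (fun t => c + ∫ τ in (0 : ℝ)..t, F τ) (F x) x := by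
  filter_upwards [hF.ae_hasDerivAt_integral] with x hx hxT
  exact (hx hxT 0 (by simp)).const_add c

/-- Logarithmic form of Grönwall's lemma for absolutely continuous functions. -/
theorem log_primitive {D : ℝ → ℝ} {T c : ℝ} (hT : 0 ≤ T) (hD : IntervalIntegrable D volume 0 T)
    (h1 : ∀ t ∈ Set.Icc 0 T, 1 ≤ c + ∫ τ in (0 : ℝ)..t, D τ) :
    Real.log (c + ∫ τ in (0 : ℝ)..T, D τ) =
      Real.log c + ∫ t in (0 : ℝ)..T, D t / (c + ∫ τ in (0 : ℝ)..t, D τ) := by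
  have hac := absolutelyContinuous_log (absolutelyContinuous_primitive (c := c) hD)
    (by rwa [Set.uIcc_of_le hT])
  have h := hac.integral_deriv_eq_sub
  simp only [intervalIntegral.integral_same, add_zero] at h
  rw [eq_comm, ← eq_sub_iff_add_eq', ← h]
  refine intervalIntegral.integral_congr_ae ?_
  filter_upwards [ae_hasDerivAt_primitive (c := c) hD] with t ht htT
  have htT' := Set.uIoc_subset_uIcc htT
  have h2 := h1 t (by rwa [Set.uIcc_of_le hT] at htT')
  exact ((ht htT').log (by positivity)).deriv.symm

/-- Grönwall's inequality in integral form. -/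
theorem gronwall_integral {Y : ℝ → ℝ} {T c K : ℝ} (hT : 0 ≤ T) (hK : 0 ≤ K) (hc : 1 ≤ c)
    (hY : ContinuousOn Y (Set.Icc 0 T)) (hY0 : ∀ t ∈ Set.Icc 0 T, 0 ≤ Y t)
    (h : ∀ t ∈ Set.Icc 0 T, Y t ≤ c + ∫ τ in (0 : ℝ)..t, K * Y τ) :
    Y T ≤ c * Real.exp (K * T) := by
  have hD : IntervalIntegrable (fun τ => K * Y τ) volume 0 T :=
    (continuousOn_const.mul hY).intervalIntegrable_of_Icc hT
  have hpos : ∀ t ∈ Set.Icc 0 T, c ≤ c + ∫ τ in (0 : ℝ)..t, K * Y τ := fun t ht =>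
    le_add_of_nonneg_right (intervalIntegral.integral_nonneg ht.1 fun τ hτ =>
      mul_nonneg hK (hY0 τ ⟨hτ.1, hτ.2.trans ht.2⟩))
  have hlog := log_primitive hT hD fun t ht => hc.trans (hpos t ht)
  have hTm : T ∈ Set.Icc 0 T := ⟨hT, le_rfl⟩
  -- The integrand is the logarithmic derivative of the right-hand side of `h`. By `h` itself it is
  -- at most `K`.
  have hle : ∫ t in (0 : ℝ)..T, K * Y t / (c + ∫ τ in (0 : ℝ)..t, K * Y τ) ≤
      ∫ _ in (0 : ℝ)..T, K := by
    refine intervalIntegral.integral_mono_on hT ?_ (by simp) fun t ht => ?_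
    · refine ContinuousOn.intervalIntegrable_of_Icc hT ?_
      refine (continuousOn_const.mul hY).div ?_ fun t ht => (zero_lt_one.trans_le (hc.trans (hpos t ht))).ne'
      have := (absolutelyContinuous_primitive (c := c) hD).continuousOn
      rwa [Set.uIcc_of_le hT] at this
    · have hp : 0 < c + ∫ τ in (0 : ℝ)..t, K * Y τ := zero_lt_one.trans_le (hc.trans (hpos t ht))
      rw [div_le_iff₀ hp]
      exact mul_le_mul_of_nonneg_left (h t ht) hK
  have hp : 0 < c + ∫ τ in (0 : ℝ)..T, K * Y τ := zero_lt_one.trans_le (hc.trans (hpos T hTm))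
  refine (h T hTm).trans ?_
  rw [← Real.exp_log hp, hlog, Real.exp_add, Real.exp_log (by positivity)]
  simp only [intervalIntegral.integral_const, sub_zero, smul_eq_mul] at hle
  rw [mul_comm K]
  gcongr

/-- Integration by parts of an absolutely continuous function against itself. -/
theorem sq_primitive {F : ℝ → ℝ} {T c : ℝ} (hF : IntervalIntegrable F volume 0 T) :
    (c + ∫ τ in (0 : ℝ)..T, F τ) ^ 2 =
      c ^ 2 + ∫ t in (0 : ℝ)..T, 2 * ((c + ∫ τ in (0 : ℝ)..t, F τ) * F t) := by
  have hac := absolutelyContinuous_primitive (c := c) hF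
  have h := hac.integral_deriv_mul_eq_sub hac
  simp only [intervalIntegral.integral_same, add_zero] at h
  rw [sq, sq, eq_comm, ← eq_sub_iff_add_eq', ← h]
  refine intervalIntegral.integral_congr_ae ?_
  filter_upwards [ae_hasDerivAt_primitive (c := c) hF] with t ht htT
  rw [(ht (Set.uIoc_subset_uIcc htT)).deriv]
  ring

/-- The energy identity for one complex coefficient. -/
theorem norm_sq_primitive {z F : ℝ → ℂ} {T : ℝ} {c : ℂ}
    (hF : IntervalIntegrable F volume 0 T)
    (hz : ∀ t ∈ Set.Icc 0 T, z t = c - ∫ τ in (0 : ℝ)..t, F τ) {t : ℝ} (ht : t ∈ Set.Icc 0 T) :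
    ‖z t‖ ^ 2 = ‖c‖ ^ 2 - 2 * ∫ τ in (0 : ℝ)..t, (starRingEnd ℂ (z τ) * F τ).re := by
  have hFt : IntervalIntegrable F volume 0 t := hF.mono_set (by
    rw [Set.uIcc_of_le ht.1, Set.uIcc_of_le (ht.1.trans ht.2)]
    exact Set.Icc_subset_Icc_right ht.2)
  have hre : IntervalIntegrable (fun τ => (-F τ).re) volume 0 t :=
    ⟨hFt.neg.1.re, hFt.neg.2.re⟩
  have him : IntervalIntegrable (fun τ => (-F τ).im) volume 0 t :=
    ⟨hFt.neg.1.im, hFt.neg.2.im⟩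
  have zre : ∀ s ∈ Set.Icc 0 t, (z s).re = c.re + ∫ τ in (0 : ℝ)..s, (-F τ).re := by
    intro s hs
    have hFs : IntervalIntegrable F volume 0 s := hFt.mono_set (by
      rw [Set.uIcc_of_le hs.1, Set.uIcc_of_le ht.1]; exact Set.Icc_subset_Icc_right hs.2)
    have := Complex.reCLM.intervalIntegral_comp_comm hFs
    simp only [Complex.reCLM_apply] at this
    rw [hz s ⟨hs.1, hs.2.trans ht.2⟩]
    simp [← this, sub_eq_add_neg]
  have zim : ∀ s ∈ Set.Icc 0 t, (z s).im = c.im + ∫ τ in (0 : ℝ)..s, (-F τ).im := by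
    intro s hs
    have hFs : IntervalIntegrable F volume 0 s := hFt.mono_set (by
      rw [Set.uIcc_of_le hs.1, Set.uIcc_of_le ht.1]; exact Set.Icc_subset_Icc_right hs.2)
    have := Complex.imCLM.intervalIntegral_comp_comm hFs
    simp only [Complex.imCLM_apply] at this
    rw [hz s ⟨hs.1, hs.2.trans ht.2⟩]
    simp [← this, sub_eq_add_neg]
  have e1 := sq_primitive (c := c.re) hre
  have e2 := sq_primitive (c := c.im) him
  have htt : t ∈ Set.Icc 0 t := ⟨ht.1, le_rfl⟩
  rw [← Complex.normSq_eq_norm_sq, ← Complex.normSq_eq_norm_sq, Complex.normSq_apply,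
    Complex.normSq_apply, ← sq, ← sq, ← sq, ← sq, zre t htt, zim t htt, e1, e2,
    ← intervalIntegral.integral_const_mul]
  have hcont : ∀ {f : ℝ → ℝ} {c : ℝ}, IntervalIntegrable f volume 0 t →
      IntervalIntegrable (fun s => 2 * ((c + ∫ τ in (0 : ℝ)..s, f τ) * f s)) volume 0 t :=
    fun hf => (hf.continuousOn_mul (absolutelyContinuous_primitive hf).continuousOn).const_mul 2
  have : ∀ a b c d e : ℝ, b + d = -e → a + b + (c + d) = a + c - e := by intros; linarith
  refine this _ _ _ _ _ ?_
  rw [← intervalIntegral.integral_add (hcont hre) (hcont him), ← intervalIntegral.integral_neg]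
  refine intervalIntegral.integral_congr fun s hs => ?_
  rw [Set.uIcc_of_le ht.1] at hs
  simp only [← zre s hs, ← zim s hs]
  simp
  ring

/-- Weighted energy identity, summed over countably many coefficients. -/
theorem weighted_energy {ι : Type*} [Countable ι] {z F : ι → ℝ → ℂ} {c : ι → ℂ} {w : ι → ℝ}
    {B : ℝ → ℝ} {T : ℝ} (hF : ∀ k, IntervalIntegrable (F k) volume 0 T)
    (hz : ∀ k, ∀ t ∈ Set.Icc 0 T, z k t = c k - ∫ τ in (0 : ℝ)..t, F k τ)
    (hw : ∀ k, 0 ≤ w k) (hB : IntervalIntegrable B volume 0 T)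
    (hsum : ∀ t ∈ Set.Icc 0 T, Summable fun k => w k * (‖z k t‖ * ‖F k t‖))
    (hle : ∀ t ∈ Set.Icc 0 T, ∑' k, w k * (‖z k t‖ * ‖F k t‖) ≤ B t)
    (h0 : Summable fun k => w k * ‖c k‖ ^ 2)
    (hT : 0 ≤ T) :
    IntervalIntegrable (fun τ => ∑' k, w k * (starRingEnd ℂ (z k τ) * F k τ).re) volume 0 T ∧
    ∀ t ∈ Set.Icc 0 T, ∑' k, w k * ‖z k t‖ ^ 2 = ∑' k, w k * ‖c k‖ ^ 2 -
        2 * ∫ τ in (0 : ℝ)..t, ∑' k, w k * (starRingEnd ℂ (z k τ) * F k τ).re := by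
  have hFs : ∀ k, ∀ t ∈ Set.Icc 0 T, IntervalIntegrable (F k) volume 0 t := fun k t ht =>
    (hF k).mono_set (by
      rw [Set.uIcc_of_le ht.1, Set.uIcc_of_le hT]; exact Set.Icc_subset_Icc_right ht.2)
  have hcont : ∀ k, ContinuousOn (z k) (Set.Icc 0 T) := by
    intro k
    have := intervalIntegral.continuousOn_primitive_interval' (hF k) (a := 0) (by simp)
    rw [Set.uIcc_of_le hT] at this
    exact (continuousOn_const.sub this).congr fun t ht => hz k t ht
  have hzm : ∀ k, AEStronglyMeasurable (z k) (volume.restrict (Set.uIoc 0 T)) := fun k => by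
    rw [Set.uIoc_of_le hT]
    exact ((hcont k).mono Set.Ioc_subset_Icc_self).aestronglyMeasurable measurableSet_Ioc
  have hFm : ∀ k, AEStronglyMeasurable (F k) (volume.restrict (Set.uIoc 0 T)) := fun k =>
    (hF k).def'.aestronglyMeasurable
  have hterm : ∀ k, AEStronglyMeasurable
      (fun τ => w k * (starRingEnd ℂ (z k τ) * F k τ).re) (volume.restrict (Set.uIoc 0 T)) :=
    fun k => ((((Complex.continuous_conj.comp_aestronglyMeasurable (hzm k)).mul (hFm k)).re)).const_mul
      (w k)
  have hmem : ∀ᵐ τ ∂(volume.restrict (Set.uIoc 0 T)), τ ∈ Set.Icc 0 T := by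
    rw [Set.uIoc_of_le hT]
    exact (ae_restrict_mem measurableSet_Ioc).mono fun τ hτ => Set.Ioc_subset_Icc_self hτ
  have tsum_meas : ∀ f : ι → ℝ → ℝ,
      (∀ k, AEStronglyMeasurable (f k) (volume.restrict (Set.uIoc 0 T))) →
      (∀ t ∈ Set.Icc 0 T, Summable fun k => f k t) →
      AEStronglyMeasurable (fun t => ∑' k, f k t) (volume.restrict (Set.uIoc 0 T)) := by
    intro f hf hs
    refine aestronglyMeasurable_of_tendsto_ae (u := atTop)
      -- Countability of the index set makes `atTop` on finite subsets countably generated, so the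
      -- limit of the finite sums is measurable.
      (f := fun (s : Finset ι) t => ∑ k ∈ s, f k t) ?_ ?_
    · exact fun s => Finset.aestronglyMeasurable_fun_sum s fun k _ => hf k
    · filter_upwards [hmem] with t ht using (hs t ht).hasSum
  have hbd : ∀ k t, ‖w k * (starRingEnd ℂ (z k t) * F k t).re‖ ≤ w k * (‖z k t‖ * ‖F k t‖) := by
    intro k t
    rw [norm_mul, Real.norm_of_nonneg (hw k)]
    refine mul_le_mul_of_nonneg_left ?_ (hw k)
    rw [Real.norm_eq_abs]
    refine (Complex.abs_re_le_norm _).trans ?_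
    rw [norm_mul, RCLike.norm_conj]
  have hsum' : ∀ t ∈ Set.Icc 0 T, Summable fun k => w k * (starRingEnd ℂ (z k t) * F k t).re :=
    fun t ht => Summable.of_norm_bounded (hsum t ht) fun k => hbd k t
  have hboundint : IntervalIntegrable (fun t => ∑' k, w k * (‖z k t‖ * ‖F k t‖)) volume 0 T := by
    refine hB.mono_fun' (tsum_meas _ (fun k => ((hzm k).norm.mul (hFm k).norm).const_mul _) hsum) ?_
    filter_upwards [hmem] with t ht
    rw [Real.norm_of_nonneg (tsum_nonneg fun k => mul_nonneg (hw k) (by positivity))]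
    exact hle t ht
  refine ⟨hboundint.mono_fun' (tsum_meas _ hterm hsum') ?_, fun t ht => ?_⟩
  · filter_upwards [hmem] with t ht
    exact tsum_of_norm_bounded (hsum t ht).hasSum fun k => hbd k t
  · have hsub : Set.uIcc 0 t ⊆ Set.uIcc 0 T := by
      rw [Set.uIcc_of_le ht.1, Set.uIcc_of_le hT]; exact Set.Icc_subset_Icc_right ht.2
    have hsub' : Set.uIoc 0 t ⊆ Set.Icc 0 T := by
      rw [Set.uIoc_of_le ht.1]
      exact Set.Ioc_subset_Icc_self.trans (Set.Icc_subset_Icc_right ht.2)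
    have hsub'' : Set.uIoc 0 t ⊆ Set.uIoc 0 T := by
      rw [Set.uIoc_of_le ht.1, Set.uIoc_of_le hT]
      exact Set.Ioc_subset_Ioc_right ht.2
    -- The coefficientwise identities are summed by dominated convergence. Only an integrable
    -- majorant `B` of the absolute series is needed, not a bound uniform in time.
    have key := intervalIntegral.hasSum_integral_of_dominated_convergence (a := 0) (b := t)
      (μ := volume) (F := fun k τ => w k * (starRingEnd ℂ (z k τ) * F k τ).re)
      (f := fun τ => ∑' k, w k * (starRingEnd ℂ (z k τ) * F k τ).re)
      (fun k τ => w k * (‖z k τ‖ * ‖F k τ‖))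
      (fun k => (hterm k).mono_measure (Measure.restrict_mono hsub'' le_rfl))
      (fun k => Eventually.of_forall fun τ _ => hbd k τ)
      (Eventually.of_forall fun τ hτ => hsum τ (hsub' hτ))
      (hboundint.mono_set hsub)
      (Eventually.of_forall fun τ hτ => (hsum' τ (hsub' hτ)).hasSum)
    have := (h0.hasSum.sub (key.mul_left 2)).tsum_eq
    rw [← this]
    refine tsum_congr fun k => ?_
    rw [norm_sq_primitive (hF k) (hz k) ht, intervalIntegral.integral_const_mul]
    ring

/-! ### Frequency weights and weighted `ℓ²` norms -/

/-- Frequencies. -/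
abbrev Freq : Type := Fin 2 → ℤ

/-- The frequency weight `1 + |k₀| + |k₁|`. -/
def J (k : Freq) : ℝ := 1 + |(k 0 : ℝ)| + |(k 1 : ℝ)|

theorem one_le_J (k : Freq) : 1 ≤ J k := by
  have := abs_nonneg (k 0 : ℝ); have := abs_nonneg (k 1 : ℝ); unfold J; linarith

theorem J_pos (k : Freq) : 0 < J k := zero_lt_one.trans_le (one_le_J k)

theorem J_neg (k : Freq) : J (-k) = J k := by simp [J]

theorem J_le_add (m l : Freq) : J m ≤ J (m - l) + J l := by
  have h0 := abs_add_le ((m 0 : ℝ) - l 0) (l 0)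
  have h1 := abs_add_le ((m 1 : ℝ) - l 1) (l 1)
  simp only [sub_add_cancel] at h0 h1
  simp only [J, Pi.sub_apply, Int.cast_sub]
  linarith

/-- Two-sided triangle inequality: the change of weight between interacting frequencies is paid for
by the velocity frequency `m - l`. -/
theorem abs_J_sub_le (m l : Freq) : |J m - J l| ≤ J (m - l) := by
  rw [abs_sub_le_iff]
  have h1 := J_le_add m l
  have h2 := J_le_add l m
  have h3 : J (l - m) = J (m - l) := by rw [← J_neg, neg_sub]
  constructor <;> linarith

theorem abs_le_J (k : Freq) (i : Fin 2) : |(k i : ℝ)| ≤ J k := by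
  have := abs_nonneg (k 0 : ℝ); have := abs_nonneg (k 1 : ℝ)
  unfold J
  fin_cases i <;> simp <;> linarith

/-- In two dimensions `J^{-4}` is summable, because `J²` dominates the product `(1 + |k₀|)(1 +
|k₁|)`. -/
theorem summable_inv_J : Summable fun k : Freq => ((J k ^ 2)⁻¹) ^ 2 := by
  have h1 : Summable fun n : ℤ => ((1 + |(n : ℝ)|) ^ 2)⁻¹ := by
    have h : Summable fun n : ℕ => ((1 + (n : ℝ)) ^ 2)⁻¹ := by
      have := (summable_nat_add_iff 1).2 (Real.summable_nat_pow_inv.2 one_lt_two)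
      refine this.congr fun n => ?_
      push_cast
      rw [add_comm]
    exact Summable.of_nat_of_neg (by simpa using h) (by simpa using h)
  have h2 : Summable fun p : ℤ × ℤ => ((1 + |(p.1 : ℝ)|) ^ 2)⁻¹ * ((1 + |(p.2 : ℝ)|) ^ 2)⁻¹ :=
    h1.mul_of_nonneg h1 (fun n => by positivity) (fun n => by positivity)
  have h3 := (Equiv.summable_iff (finTwoArrowEquiv ℤ)).2 h2
  refine Summable.of_nonneg_of_le (fun k => by positivity) (fun k => ?_) h3
  change ((J k ^ 2)⁻¹) ^ 2 ≤ ((1 + |(k 0 : ℝ)|) ^ 2)⁻¹ * ((1 + |(k 1 : ℝ)|) ^ 2)⁻¹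
  rw [← mul_inv, inv_pow]
  refine inv_anti₀ (by positivity) ?_
  rw [← mul_pow]
  refine pow_le_pow_left₀ (by positivity) ?_ 2
  have := abs_nonneg (k 0 : ℝ); have := abs_nonneg (k 1 : ℝ)
  unfold J
  nlinarith

/-- Square summability with weight `J ^ s`. -/
def WSummable (s : ℕ) (x : Freq → ℝ) : Prop := Summable fun k => (J k ^ s * x k) ^ 2

/-- The weighted `ℓ²` norm. -/
noncomputable def wnorm (s : ℕ) (x : Freq → ℝ) : ℝ := √(∑' k, (J k ^ s * x k) ^ 2)

theorem wnorm_nonneg (s : ℕ) (x : Freq → ℝ) : 0 ≤ wnorm s x := Real.sqrt_nonneg _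

theorem wnorm_sq (s : ℕ) (x : Freq → ℝ) : wnorm s x ^ 2 = ∑' k, (J k ^ s * x k) ^ 2 :=
  Real.sq_sqrt (tsum_nonneg fun _ => sq_nonneg _)

theorem weight_mono {s t : ℕ} (hst : s ≤ t) (x : Freq → ℝ) (k : Freq) :
    (J k ^ s * x k) ^ 2 ≤ (J k ^ t * x k) ^ 2 := by
  rw [mul_pow, mul_pow]
  have h1 := pow_le_pow_right₀ (one_le_J k) hst
  have h2 := J_pos k
  gcongr

theorem WSummable.mono {s t : ℕ} {x : Freq → ℝ} (h : WSummable t x) (hst : s ≤ t) :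
    WSummable s x :=
  Summable.of_nonneg_of_le (fun _ => sq_nonneg _) (weight_mono hst x) h

theorem wnorm_mono {s t : ℕ} {x : Freq → ℝ} (h : WSummable t x) (hst : s ≤ t) :
    wnorm s x ≤ wnorm t x :=
  Real.sqrt_le_sqrt ((h.mono hst).tsum_le_tsum (weight_mono hst x) h)

/-- The Cauchy–Schwarz inequality for sequences. -/
theorem cauchy_schwarz {ι : Type*} {x y : ι → ℝ} (hx0 : ∀ k, 0 ≤ x k) (hy0 : ∀ k, 0 ≤ y k)
    (hx : Summable fun k => x k ^ 2) (hy : Summable fun k => y k ^ 2) :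
    Summable (fun k => x k * y k) ∧ ∑' k, x k * y k ≤ √(∑' k, x k ^ 2) * √(∑' k, y k ^ 2) := by
  have := Real.summable_and_inner_le_Lp_mul_Lq_tsum_of_nonneg Real.HolderConjugate.two_two hx0 hy0
    (by simpa using hx) (by simpa using hy)
  simpa [Real.sqrt_eq_rpow] using this

/-- The constant in the embedding of weighted `ℓ²` into `ℓ¹`. -/
noncomputable def embConst : ℝ := √(∑' k : Freq, ((J k ^ 2)⁻¹) ^ 2)

theorem embConst_nonneg : 0 ≤ embConst := Real.sqrt_nonneg _

/-- Cauchy–Schwarz against `J^{-2}`: the passage from `ℓ²` to `ℓ¹` costs two powers of the weight.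
This is the Fourier form of the Sobolev embedding. -/
theorem summable_of_wSummable {s : ℕ} {x : Freq → ℝ} (hx0 : ∀ k, 0 ≤ x k)
    (hx : WSummable (s + 2) x) :
    Summable (fun k => J k ^ s * x k) ∧
      ∑' k, J k ^ s * x k ≤ embConst * wnorm (s + 2) x := by
  have h := cauchy_schwarz (fun k => inv_nonneg.2 (pow_nonneg (J_pos k).le 2))
    (fun k => mul_nonneg (pow_nonneg (J_pos k).le (s + 2)) (hx0 k)) summable_inv_J hx
  have e : (fun k => (J k ^ 2)⁻¹ * (J k ^ (s + 2) * x k)) = fun k => J k ^ s * x k := by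
    ext k
    have := (J_pos k).ne'
    rw [pow_add]
    field_simp
  rwa [e] at h

theorem summable_prod_fiber {κ ι : Type*} {F : κ × ι → ℝ} {c : κ → ℝ} {B : ℝ} (hF : ∀ p, 0 ≤ F p)
    (hs : ∀ k, Summable fun l => F (k, l)) (hle : ∀ k, ∑' l, F (k, l) ≤ c k * B)
    (hc : Summable c) : Summable F ∧ ∑' p, F p ≤ (∑' k, c k) * B := by
  have h1 : Summable fun k => ∑' l, F (k, l) :=
    Summable.of_nonneg_of_le (fun k => tsum_nonneg fun l => hF _) hle (hc.mul_right B)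
  have h2 : Summable F := (summable_prod_of_nonneg hF).2 ⟨hs, h1⟩
  refine ⟨h2, ?_⟩
  rw [h2.tsum_prod' hs, ← tsum_mul_right]
  exact h1.tsum_le_tsum hle (hc.mul_right B)

/-! ### Young's inequalities and pointwise bounds for differences of truncated weights -/

/-- Young's inequality `ℓ¹ * ℓ² ⊆ ℓ²`, in trilinear form. -/
theorem young_one {a x y : Freq → ℝ} (ha0 : ∀ k, 0 ≤ a k) (hx0 : ∀ k, 0 ≤ x k)
    (hy0 : ∀ k, 0 ≤ y k) (ha : Summable a) (hx : Summable fun k => x k ^ 2)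
    (hy : Summable fun k => y k ^ 2) :
    Summable (fun p : Freq × Freq => a (p.1 - p.2) * x p.1 * y p.2) ∧
      ∑' p : Freq × Freq, a (p.1 - p.2) * x p.1 * y p.2 ≤
        (∑' k, a k) * (√(∑' k, x k ^ 2) * √(∑' k, y k ^ 2)) := by
  -- The coordinates (difference, second frequency) isolate the `ℓ¹` factor. On each fibre
  -- Cauchy–Schwarz gives a bound independent of the difference.
  let e : Freq × Freq ≃ Freq × Freq :=
    ⟨fun p => (p.1 + p.2, p.2), fun p => (p.1 - p.2, p.2), fun p => by simp, fun p => by simp⟩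
  have hfib : ∀ k : Freq, Summable (fun l => x (k + l) * y l) ∧
      ∑' l, x (k + l) * y l ≤ √(∑' k, x k ^ 2) * √(∑' k, y k ^ 2) := by
    intro k
    have hx' : Summable fun l => x (k + l) ^ 2 :=
      (Equiv.summable_iff (f := fun l => x l ^ 2) (Equiv.addLeft k)).2 hx
    have h := cauchy_schwarz (fun l => hx0 (k + l)) hy0 hx' hy
    have e := (Equiv.addLeft k).tsum_eq fun l => x l ^ 2
    simp only [Equiv.coe_addLeft] at e
    rwa [e] at h
  have h := summable_prod_fiber (F := fun p : Freq × Freq => a p.1 * (x (p.1 + p.2) * y p.2))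
    (c := a) (B := √(∑' k, x k ^ 2) * √(∑' k, y k ^ 2))
    (fun p => mul_nonneg (ha0 _) (mul_nonneg (hx0 _) (hy0 _)))
    (fun k => (hfib k).1.mul_left (a k))
    (fun k => by dsimp only; rw [tsum_mul_left]; exact mul_le_mul_of_nonneg_left (hfib k).2 (ha0 k)) ha
  have hcomp : (fun p : Freq × Freq => a p.1 * (x (p.1 + p.2) * y p.2)) =
      (fun p : Freq × Freq => a (p.1 - p.2) * x p.1 * y p.2) ∘ e := by
    ext p
    simp [e, mul_assoc]
  rw [hcomp, Equiv.summable_iff] at h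
  refine ⟨h.1, ?_⟩
  rw [← e.tsum_eq]
  exact h.2

/-- Young's inequality `ℓ² * ℓ¹ ⊆ ℓ²`, in trilinear form. -/
theorem young_two {a x y : Freq → ℝ} (ha0 : ∀ k, 0 ≤ a k) (hx0 : ∀ k, 0 ≤ x k)
    (hy0 : ∀ k, 0 ≤ y k) (ha : Summable fun k => a k ^ 2) (hx : Summable fun k => x k ^ 2)
    (hy : Summable y) :
    Summable (fun p : Freq × Freq => a (p.1 - p.2) * x p.1 * y p.2) ∧
      ∑' p : Freq × Freq, a (p.1 - p.2) * x p.1 * y p.2 ≤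
        (∑' k, y k) * (√(∑' k, a k ^ 2) * √(∑' k, x k ^ 2)) := by
  have hfib : ∀ l : Freq, Summable (fun m => a (m - l) * x m) ∧
      ∑' m, a (m - l) * x m ≤ √(∑' k, a k ^ 2) * √(∑' k, x k ^ 2) := by
    intro l
    have ha' : Summable fun m => a (m - l) ^ 2 :=
      (Equiv.summable_iff (f := fun m => a m ^ 2) (Equiv.subRight l)).2 ha
    have h := cauchy_schwarz (fun m => ha0 (m - l)) hx0 ha' hx
    have e := (Equiv.subRight l).tsum_eq fun m => a m ^ 2
    simp only [Equiv.subRight_apply] at e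
    rwa [e] at h
  have h := summable_prod_fiber (F := fun p : Freq × Freq => y p.1 * (a (p.2 - p.1) * x p.2))
    (c := y) (B := √(∑' k, a k ^ 2) * √(∑' k, x k ^ 2))
    (fun p => mul_nonneg (hy0 _) (mul_nonneg (ha0 _) (hx0 _)))
    (fun k => (hfib k).1.mul_left (y k))
    (fun k => by dsimp only; rw [tsum_mul_left]; exact mul_le_mul_of_nonneg_left (hfib k).2 (hy0 k)) hy
  have hcomp : (fun p : Freq × Freq => y p.1 * (a (p.2 - p.1) * x p.2)) =
      (fun p : Freq × Freq => a (p.1 - p.2) * x p.1 * y p.2) ∘ Equiv.prodComm _ _ := by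
    ext p
    simp [mul_comm, mul_left_comm]
  rw [hcomp, Equiv.summable_iff] at h
  refine ⟨h.1, ?_⟩
  rw [← (Equiv.prodComm Freq Freq).tsum_eq]
  exact h.2

/-- Truncation `min · N` is 1-Lipschitz and does not increase its argument, so the mean value bound
for the power survives with a constant free of `N`. -/
theorem min_pow_sub_le {a c N κ : ℝ} {n : ℕ} (hc : 0 ≤ c) (hca : c ≤ a) (hN : 0 ≤ N)
    (h : a - c ≤ κ) : |min a N ^ n - min c N ^ n| ≤ n * κ * a ^ (n - 1) := by
  have hq : 0 ≤ min c N := le_min hc hN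
  have hqp : min c N ≤ min a N := min_le_min_right N hca
  have hpa : min a N ≤ a := min_le_left _ _
  have hd : min a N - min c N ≤ κ := by
    refine le_trans ?_ h
    rcases le_total c N with hcN | hcN
    · rw [min_eq_left hcN]; linarith
    · rw [min_eq_right hcN, min_eq_right (hcN.trans hca)]; linarith
  refine (abs_pow_sub_pow_le ..).trans ?_
  rw [abs_of_nonneg (sub_nonneg.2 hqp), abs_of_nonneg hq, abs_of_nonneg (hq.trans hqp),
    max_eq_left hqp, mul_comm (n : ℝ) κ]
  have hp : 0 ≤ min a N := hq.trans hqp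
  have hκ : 0 ≤ κ := (sub_nonneg.2 hca).trans h
  gcongr

/-- Here `a`, `c`, `κ` stand for `J m`, `J l`, `J (m - l)`. In each product on the right one factor
has power one and the other two have power three; the first can be placed in `ℓ¹`, as it is two
powers below the available regularity, and the others in `ℓ²`. The last term only restores the
symmetry in `a` and `c`. -/
theorem kernel_six {a c N κ : ℝ} (ha : 0 ≤ a) (hc : 0 ≤ c) (hN : 0 ≤ N) (h : |a - c| ≤ κ) :
    |min a N ^ 6 - min c N ^ 6| * min a c ≤
      12 * (κ * (a ^ 3 * c ^ 3) + κ ^ 3 * (a ^ 3 * c) + κ ^ 3 * (c ^ 3 * a)) := by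
  wlog hca : c ≤ a generalizing a c
  · have := this hc ha (by rwa [abs_sub_comm]) (le_of_not_ge hca)
    rw [abs_sub_comm, min_comm a c]
    refine this.trans (le_of_eq ?_)
    ring
  have hκ : 0 ≤ κ := (abs_nonneg _).trans h
  have h1 := min_pow_sub_le (n := 6) hc hca hN ((le_abs_self _).trans h)
  rw [min_eq_right hca]
  refine (mul_le_mul_of_nonneg_right h1 hc).trans ?_
  -- In `6 κ a⁵ c` the surplus factor `a²` is split by `a ≤ c + κ`; hence the constant `12 = 6 · 2`.
  have h2 : a ^ 2 ≤ 2 * c ^ 2 + 2 * κ ^ 2 := by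
    have : a ≤ c + κ := by linarith [(le_abs_self _).trans h]
    nlinarith [sq_nonneg (c - κ), pow_le_pow_left₀ ha this 2]
  have h3 : 0 ≤ κ * a ^ 3 * c := by positivity
  have h4 : 0 ≤ κ ^ 3 * (c ^ 3 * a) := by positivity
  have := mul_le_mul_of_nonneg_left h2 h3
  norm_num
  nlinarith

/-- The analogue for W^{2,2}: each product again leaves one factor two powers below its regularity
(three for the velocity, two for the vorticity). -/
theorem kernel_four {a c N κ : ℝ} (ha : 0 ≤ a) (hc : 0 ≤ c) (hN : 0 ≤ N) (h : |a - c| ≤ κ) :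
    |min a N ^ 4 - min c N ^ 4| * min a c ≤
      8 * (κ * (a ^ 2 * c ^ 2) + κ ^ 3 * a ^ 2 + κ ^ 3 * c ^ 2) := by
  wlog hca : c ≤ a generalizing a c
  · have := this hc ha (by rwa [abs_sub_comm]) (le_of_not_ge hca)
    rw [abs_sub_comm, min_comm a c]
    refine this.trans (le_of_eq ?_)
    ring
  have hκ : 0 ≤ κ := (abs_nonneg _).trans h
  have h1 := min_pow_sub_le (n := 4) hc hca hN ((le_abs_self _).trans h)
  rw [min_eq_right hca]
  refine (mul_le_mul_of_nonneg_right h1 hc).trans ?_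
  -- Applied to `4 κ a³ c = 4 κ a² (a c)`.
  have h2 : a * c ≤ 2 * c ^ 2 + κ ^ 2 := by
    have : a ≤ c + κ := by linarith [(le_abs_self _).trans h]
    nlinarith [sq_nonneg (c - κ), mul_le_mul_of_nonneg_right this hc]
  have h3 : 0 ≤ κ * a ^ 2 := by positivity
  have h4 : 0 ≤ κ ^ 3 * c ^ 2 := by positivity
  have h5 : 0 ≤ κ ^ 3 * a ^ 2 := by positivity
  have := mul_le_mul_of_nonneg_left h2 h3
  norm_num
  nlinarith

/-! ### The transport operator on the Fourier side and its antisymmetry -/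

/-- The symbol `û(k) · l`. -/
noncomputable def dotf (u : Fin 2 → Freq → ℂ) (k l : Freq) : ℂ := u 0 k * l 0 + u 1 k * l 1

/-- The size of a Fourier coefficient of a vector field. -/
noncomputable def amp (u : Fin 2 → Freq → ℂ) (k : Freq) : ℝ := ‖u 0 k‖ + ‖u 1 k‖

theorem amp_nonneg (u : Fin 2 → Freq → ℂ) (k : Freq) : 0 ≤ amp u k := by unfold amp; positivity

/-- Fourier coefficients of real divergence free vector fields. -/
structure IsSolenoidal (u : Fin 2 → Freq → ℂ) : Prop where
  div : ∀ k, dotf u k k = 0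
  conj : ∀ i k, u i (-k) = starRingEnd ℂ (u i k)

theorem IsSolenoidal.amp_neg {u : Fin 2 → Freq → ℂ} (hu : IsSolenoidal u) (k : Freq) :
    amp u (-k) = amp u k := by
  simp [amp, hu.conj]

theorem norm_dotf_le (u : Fin 2 → Freq → ℂ) (k l : Freq) : ‖dotf u k l‖ ≤ amp u k * J l := by
  refine (norm_add_le _ _).trans ?_
  rw [norm_mul, norm_mul, amp, add_mul]
  have h0 : ‖((l 0 : ℤ) : ℂ)‖ ≤ J l := by
    rw [Complex.norm_intCast]; exact abs_le_J l 0
  have h1 : ‖((l 1 : ℤ) : ℂ)‖ ≤ J l := by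
    rw [Complex.norm_intCast]; exact abs_le_J l 1
  gcongr

/-- The coefficient of `u` at `m - l` is orthogonal to `m - l`, so the derivative may be read at the
input frequency or at the output frequency. -/
theorem IsSolenoidal.dotf_sub {u : Fin 2 → Freq → ℂ} (hu : IsSolenoidal u) (m l : Freq) :
    dotf u (m - l) l = dotf u (m - l) m := by
  have h := hu.div (m - l)
  simp only [dotf, Pi.sub_apply, Int.cast_sub] at h ⊢
  linear_combination -h

/-- The terms of the trilinear form of the transport operator. -/
noncomputable def pairing (u : Fin 2 → Freq → ℂ) (x y : Freq → ℂ) (p : Freq × Freq) : ℂ :=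
  Complex.I * dotf u (p.1 - p.2) p.2 * x p.2 * starRingEnd ℂ (y p.1)

/-- Fourier coefficients of `u · ∇ x`. -/
noncomputable def transport (u : Fin 2 → Freq → ℂ) (x : Freq → ℂ) (m : Freq) : ℂ :=
  2 * Real.pi * Complex.I * ∑' l, dotf u (m - l) l * x l

theorem norm_pairing (u : Fin 2 → Freq → ℂ) (x y : Freq → ℂ) (p : Freq × Freq) :
    ‖pairing u x y p‖ = ‖dotf u (p.1 - p.2) p.2‖ * ‖x p.2‖ * ‖y p.1‖ := by
  simp [pairing]

theorem norm_pairing_le (u : Fin 2 → Freq → ℂ) (x y : Freq → ℂ) (p : Freq × Freq) :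
    ‖pairing u x y p‖ ≤ amp u (p.1 - p.2) * ‖y p.1‖ * (J p.2 ^ 1 * ‖x p.2‖) := by
  rw [norm_pairing]
  have := norm_dotf_le u (p.1 - p.2) p.2
  calc _ ≤ amp u (p.1 - p.2) * J p.2 * ‖x p.2‖ * ‖y p.1‖ := by gcongr
    _ = _ := by ring

/-- By `IsSolenoidal.dotf_sub` the derivative can be charged to the smaller of the two frequencies.
The kernel bounds rely on this gain. -/
theorem IsSolenoidal.norm_pairing_le_min {u : Fin 2 → Freq → ℂ} (hu : IsSolenoidal u)
    (x : Freq → ℂ) (p : Freq × Freq) :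
    ‖pairing u x x p‖ ≤ amp u (p.1 - p.2) * min (J p.1) (J p.2) * (‖x p.1‖ * ‖x p.2‖) := by
  rw [norm_pairing, mul_assoc, mul_comm ‖x p.2‖]
  have h1 := norm_dotf_le u (p.1 - p.2) p.2
  have h2 := norm_dotf_le u (p.1 - p.2) p.1
  rw [← hu.dotf_sub] at h2
  rw [mul_min_of_nonneg _ _ (amp_nonneg _ _)]
  exact mul_le_mul_of_nonneg_right (le_min h2 h1) (by positivity)

/-- Reality of `u` turns conjugation into reversal of the frequency `m - l`, incompressibility moves
the derivative, and the conjugate of `i` supplies the sign. This is the skew-adjointness of `u · ∇`.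
-/
theorem IsSolenoidal.pairing_swap {u : Fin 2 → Freq → ℂ} (hu : IsSolenoidal u)
    (x : Freq → ℂ) (p : Freq × Freq) :
    (pairing u x x p.swap).re = -(pairing u x x p).re := by
  have hc : starRingEnd ℂ (dotf u (p.2 - p.1) p.1) = dotf u (p.1 - p.2) p.2 := by
    rw [hu.dotf_sub p.1 p.2, dotf, dotf, ← neg_sub p.1 p.2, hu.conj, hu.conj]
    simp
  have h : starRingEnd ℂ (pairing u x x p.swap) = -pairing u x x p := by
    simp only [pairing, Prod.fst_swap, Prod.snd_swap, map_mul, hc, Complex.conj_I, Complex.conj_conj]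
    ring
  rw [← Complex.conj_re, h, Complex.neg_re]

/-- Fubini, with the absolute summability assumed as a hypothesis, turns the weighted energy
production into a double sum over pairs of frequencies. -/
theorem tsum_transport {u : Fin 2 → Freq → ℂ} {x y : Freq → ℂ} {φ : Freq → ℝ}
    (h : Summable fun p : Freq × Freq => (φ p.1 : ℂ) * pairing u x y p) :
    ∑' m, φ m * (starRingEnd ℂ (y m) * transport u x m).re =
      2 * Real.pi * ∑' p : Freq × Freq, φ p.1 * (pairing u x y p).re := by
  have h1 : ∀ p : Freq × Freq, φ p.1 * (pairing u x y p).re =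
      ((φ p.1 : ℂ) * pairing u x y p).re := fun p => by simp
  have hre : Summable fun p : Freq × Freq => ((φ p.1 : ℂ) * pairing u x y p).re :=
    (Complex.hasSum_re h.hasSum).summable
  simp only [h1]
  rw [hre.tsum_prod, ← tsum_mul_left]
  refine tsum_congr fun m => ?_
  rw [← Complex.re_tsum (h.prod_factor m), tsum_congr fun l => ?_, tsum_mul_left (a := (φ m : ℂ) * Complex.I * starRingEnd ℂ (y m))
    (f := fun l => dotf u (m - l) l * x l)]
  · rw [← Complex.re_ofReal_mul, ← Complex.re_ofReal_mul, transport]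
    congr 1
    push_cast
    ring
  · simp only [pairing]
    ring

/-- The basic energy estimate for the transport operator. -/
theorem IsSolenoidal.energy_le {u : Fin 2 → Freq → ℂ} (hu : IsSolenoidal u) {x : Freq → ℂ}
    {φ : Freq → ℝ} {K : Freq × Freq → ℝ}
    (h : Summable fun p : Freq × Freq => (φ p.1 : ℂ) * pairing u x x p)
    (hK : Summable K) (hle : ∀ p : Freq × Freq, |φ p.1 - φ p.2| * ‖pairing u x x p‖ ≤ K p) :
    |∑' m, φ m * (starRingEnd ℂ (x m) * transport u x m).re| ≤ Real.pi * ∑' p, K p := by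
  rw [tsum_transport h]
  have hre : Summable fun p : Freq × Freq => φ p.1 * (pairing u x x p).re := by
    simpa using (Complex.hasSum_re h.hasSum).summable
  have hsw := (Equiv.prodComm Freq Freq).tsum_eq fun p => φ p.1 * (pairing u x x p).re
  have hsum : Summable fun p : Freq × Freq => φ p.2 * (pairing u x x p).re := by
    have := ((Equiv.prodComm Freq Freq).summable_iff).2 hre
    refine this.neg.congr fun p => ?_
    simp [hu.pairing_swap]
  -- Symmetrisation: averaging over the swap replaces the weight by its difference. The factor one
  -- half turns `2π` into `π`.
  have e : 2 * ∑' p : Freq × Freq, φ p.1 * (pairing u x x p).re =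
      ∑' p : Freq × Freq, (φ p.1 - φ p.2) * (pairing u x x p).re := by
    simp only [sub_mul]
    rw [hre.tsum_sub hsum, two_mul, sub_eq_add_neg]
    congr 1
    rw [← hsw, ← tsum_neg]
    refine tsum_congr fun p => ?_
    simp [hu.pairing_swap]
  have hb : |∑' p : Freq × Freq, (φ p.1 - φ p.2) * (pairing u x x p).re| ≤ ∑' p, K p := by
    rw [← Real.norm_eq_abs]
    refine tsum_of_norm_bounded hK.hasSum fun p => le_trans ?_ (hle p)
    rw [norm_mul, Real.norm_eq_abs]
    exact mul_le_mul_of_nonneg_left (Complex.abs_re_le_norm _) (abs_nonneg _)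
  rw [mul_comm 2, mul_assoc, e, abs_mul, abs_of_pos Real.pi_pos]
  exact mul_le_mul_of_nonneg_left hb Real.pi_pos.le

theorem hasSum_le_of_terms {ι : Type*} {f : ι → ℝ} {S B : ℝ} (h : Summable f ∧ ∑' i, f i ≤ S)
    (hS : S ≤ B) : Summable f ∧ ∑' i, f i ≤ B := ⟨h.1, h.2.trans hS⟩

theorem wnorm_zero (x : Freq → ℝ) : wnorm 0 x = √(∑' k, x k ^ 2) := by simp [wnorm]

/-! ### Energy estimates for transport in the weighted norms -/

section Bounds

variable {u : Fin 2 → Freq → ℂ} {x y : Freq → ℂ}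

/-- Summability of the trilinear form against a weight of order two. -/
theorem summable_pairing (hU : WSummable 3 (amp u)) (hx : WSummable 1 fun k => ‖x k‖)
    {φ : Freq → ℝ} (hφ : Summable fun k => (|φ k| * ‖y k‖) ^ 2) :
    Summable fun p : Freq × Freq => (φ p.1 : ℂ) * pairing u x y p := by
  have hU1 := (summable_of_wSummable (s := 0) (amp_nonneg u) (hU.mono (by norm_num))).1
  simp only [pow_zero, one_mul] at hU1
  have h := (young_one (amp_nonneg u) (fun k => mul_nonneg (abs_nonneg (φ k)) (norm_nonneg (y k)))
    (fun k => mul_nonneg (pow_nonneg (J_pos k).le 1) (norm_nonneg (x k))) hU1 hφ hx).1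
  refine Summable.of_norm_bounded h fun p => ?_
  rw [norm_mul, Complex.norm_real, Real.norm_eq_abs]
  refine (mul_le_mul_of_nonneg_left (norm_pairing_le u x y p) (abs_nonneg _)).trans (le_of_eq ?_)
  ring

theorem summable_bounded_weight {φ : Freq → ℝ} {M : ℝ} {s : ℕ} (hφ : ∀ k, |φ k| ≤ M * J k ^ s)
    (hy : WSummable s fun k => ‖y k‖) : Summable fun k => (|φ k| * ‖y k‖) ^ 2 := by
  refine Summable.of_nonneg_of_le (fun _ => sq_nonneg _) (fun k => ?_) (hy.mul_left (M ^ 2))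
  rw [← mul_pow]
  have := hφ k
  calc (|φ k| * ‖y k‖) ^ 2 ≤ (M * J k ^ s * ‖y k‖) ^ 2 := by gcongr
    _ = _ := by ring

theorem abs_tsum_transport_le {φ : Freq → ℝ} {K : Freq × Freq → ℝ}
    (h : Summable fun p : Freq × Freq => (φ p.1 : ℂ) * pairing u x y p)
    (hK : Summable K) (hle : ∀ p : Freq × Freq, |φ p.1| * ‖pairing u x y p‖ ≤ K p) :
    |∑' m, φ m * (starRingEnd ℂ (y m) * transport u x m).re| ≤ 2 * Real.pi * ∑' p, K p := by
  rw [tsum_transport h, abs_mul, abs_of_pos Real.two_pi_pos]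
  refine mul_le_mul_of_nonneg_left ?_ Real.two_pi_pos.le
  rw [← Real.norm_eq_abs]
  refine tsum_of_norm_bounded hK.hasSum fun p => le_trans ?_ (hle p)
  rw [norm_mul, Real.norm_eq_abs]
  exact mul_le_mul_of_nonneg_left (Complex.abs_re_le_norm _) (abs_nonneg _)

/-- Young's inequality with all the weight on the `ℓ²` factors. -/
theorem young_one_weighted {a x y : Freq → ℝ} (ha0 : ∀ k, 0 ≤ a k) (hx0 : ∀ k, 0 ≤ x k)
    (hy0 : ∀ k, 0 ≤ y k) (i : ℕ) {q r s : ℕ} (hi : i + 2 ≤ q) (ha : WSummable q a)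
    (hx : WSummable r x) (hy : WSummable s y) :
    Summable (fun p : Freq × Freq =>
        (J (p.1 - p.2) ^ i * a (p.1 - p.2)) * (J p.1 ^ r * x p.1) * (J p.2 ^ s * y p.2)) ∧
      ∑' p : Freq × Freq,
        (J (p.1 - p.2) ^ i * a (p.1 - p.2)) * (J p.1 ^ r * x p.1) * (J p.2 ^ s * y p.2) ≤
        embConst * wnorm q a * wnorm r x * wnorm s y := by
  have h1 := summable_of_wSummable ha0 (ha.mono hi)
  have h := young_one (fun k => mul_nonneg (pow_nonneg (J_pos k).le i) (ha0 k))
    (fun k => mul_nonneg (pow_nonneg (J_pos k).le r) (hx0 k))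
    (fun k => mul_nonneg (pow_nonneg (J_pos k).le s) (hy0 k)) h1.1 hx hy
  refine hasSum_le_of_terms h ?_
  rw [mul_assoc _ (wnorm r x)]
  refine mul_le_mul_of_nonneg_right (h1.2.trans ?_) (mul_nonneg (wnorm_nonneg _ _) (wnorm_nonneg _ _))
  exact mul_le_mul_of_nonneg_left (wnorm_mono ha hi) embConst_nonneg

theorem young_two_weighted {a x y : Freq → ℝ} (ha0 : ∀ k, 0 ≤ a k) (hx0 : ∀ k, 0 ≤ x k)
    (hy0 : ∀ k, 0 ≤ y k) (i : ℕ) {q r s : ℕ} (hi : i + 2 ≤ s) (ha : WSummable q a)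
    (hx : WSummable r x) (hy : WSummable s y) :
    Summable (fun p : Freq × Freq =>
        (J (p.1 - p.2) ^ q * a (p.1 - p.2)) * (J p.1 ^ r * x p.1) * (J p.2 ^ i * y p.2)) ∧
      ∑' p : Freq × Freq,
        (J (p.1 - p.2) ^ q * a (p.1 - p.2)) * (J p.1 ^ r * x p.1) * (J p.2 ^ i * y p.2) ≤
        embConst * wnorm q a * wnorm r x * wnorm s y := by
  have h1 := summable_of_wSummable hy0 (hy.mono hi)
  have h := young_two (fun k => mul_nonneg (pow_nonneg (J_pos k).le q) (ha0 k))
    (fun k => mul_nonneg (pow_nonneg (J_pos k).le r) (hx0 k))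
    (fun k => mul_nonneg (pow_nonneg (J_pos k).le i) (hy0 k)) ha hx h1.1
  refine hasSum_le_of_terms h ?_
  calc _ ≤ embConst * wnorm s y * (wnorm q a * wnorm r x) := by
        refine mul_le_mul_of_nonneg_right (h1.2.trans ?_)
          (mul_nonneg (wnorm_nonneg _ _) (wnorm_nonneg _ _))
        exact mul_le_mul_of_nonneg_left (wnorm_mono hy hi) embConst_nonneg
    _ = _ := by ring

/-- Exchanging the two frequencies reverses `m - l`, which is harmless because `a` and `J` are even.
-/
theorem young_two_weighted_swap {a x : Freq → ℝ} (ha0 : ∀ k, 0 ≤ a k) (haneg : ∀ k, a (-k) = a k)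
    (hx0 : ∀ k, 0 ≤ x k) (i : ℕ) {q r : ℕ} (hi : i + 2 ≤ r) (ha : WSummable q a)
    (hx : WSummable r x) :
    Summable (fun p : Freq × Freq =>
        (J (p.1 - p.2) ^ q * a (p.1 - p.2)) * (J p.2 ^ r * x p.2) * (J p.1 ^ i * x p.1)) ∧
      ∑' p : Freq × Freq,
        (J (p.1 - p.2) ^ q * a (p.1 - p.2)) * (J p.2 ^ r * x p.2) * (J p.1 ^ i * x p.1) ≤
        embConst * wnorm q a * wnorm r x * wnorm r x := by
  have h := young_two_weighted ha0 hx0 hx0 i hi ha hx hx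
  have e : (fun p : Freq × Freq =>
      (J (p.1 - p.2) ^ q * a (p.1 - p.2)) * (J p.2 ^ r * x p.2) * (J p.1 ^ i * x p.1)) =
      (fun p : Freq × Freq =>
        (J (p.1 - p.2) ^ q * a (p.1 - p.2)) * (J p.1 ^ r * x p.1) * (J p.2 ^ i * x p.2)) ∘
        Equiv.prodComm _ _ := by
    ext p
    simp only [Function.comp, Equiv.prodComm_apply, Prod.fst_swap, Prod.snd_swap]
    rw [← neg_sub p.1 p.2, J_neg, haneg]
  rw [e, Equiv.summable_iff]
  exact ⟨h.1, ((Equiv.prodComm Freq Freq).tsum_eq _).trans_le h.2⟩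

/-- The constant of the transport estimates. -/
noncomputable def transConst : ℝ := 36 * Real.pi * embConst

theorem transConst_nonneg : 0 ≤ transConst := by
  have := embConst_nonneg; have := Real.pi_pos; unfold transConst; positivity

theorem abs_min_pow_le {a N : ℝ} (ha : 0 ≤ a) (hN : 0 ≤ N) (n : ℕ) : |min a N ^ n| ≤ N ^ n := by
  rw [abs_of_nonneg (pow_nonneg (le_min ha hN) n)]
  exact pow_le_pow_left₀ (le_min ha hN) (min_le_right _ _) n

/-- The W^{3,2} estimate, uniform in the truncation level. The three products of `kernel_six` are
bounded by Young's inequality with the `ℓ¹` factor being the velocity, or `x` at either frequency;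
`12 · 3 = 36` gives `transConst`. -/
theorem IsSolenoidal.energy_six (hu : IsSolenoidal u) (hU : WSummable 3 (amp u))
    (hx : WSummable 3 fun k => ‖x k‖) {N : ℝ} (hN : 0 ≤ N) :
    |∑' m, min (J m) N ^ 6 * (starRingEnd ℂ (x m) * transport u x m).re| ≤
      transConst * wnorm 3 (amp u) * wnorm 3 (fun k => ‖x k‖) ^ 2 := by
  have n0 : ∀ k, 0 ≤ ‖x k‖ := fun k => norm_nonneg _
  have y1 := young_one_weighted (amp_nonneg u) n0 n0 1 le_rfl hU hx hx
  have y2 := young_two_weighted (amp_nonneg u) n0 n0 1 le_rfl hU hx hx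
  have y3 := young_two_weighted_swap (amp_nonneg u) hu.amp_neg n0 1 le_rfl hU hx
  have hs := summable_pairing (x := x) (y := x) (φ := fun k => min (J k) N ^ 6) hU
    (hx.mono (by norm_num)) (summable_bounded_weight (M := N ^ 6) (s := 0)
      (fun k => by simpa using abs_min_pow_le (J_pos k).le hN 6) (hx.mono (by norm_num)))
  have hsum := ((y1.1.add y2.1).add y3.1).mul_left 12
  refine (hu.energy_le (φ := fun k => min (J k) N ^ 6) hs hsum fun p => ?_).trans ?_
  · have hk := kernel_six (J_pos p.1).le (J_pos p.2).le hN (abs_J_sub_le p.1 p.2)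
    have hp := hu.norm_pairing_le_min x p
    have ha := amp_nonneg u (p.1 - p.2)
    calc _ ≤ |min (J p.1) N ^ 6 - min (J p.2) N ^ 6| *
          (amp u (p.1 - p.2) * min (J p.1) (J p.2) * (‖x p.1‖ * ‖x p.2‖)) := by gcongr
      _ = (|min (J p.1) N ^ 6 - min (J p.2) N ^ 6| * min (J p.1) (J p.2)) *
          (amp u (p.1 - p.2) * (‖x p.1‖ * ‖x p.2‖)) := by ring
      _ ≤ _ := mul_le_mul_of_nonneg_right hk (by positivity)
      _ = _ := by ring
  · rw [tsum_mul_left, (y1.1.add y2.1).tsum_add y3.1, y1.1.tsum_add y2.1]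
    have := Real.pi_pos
    calc _ ≤ Real.pi * (12 * (embConst * wnorm 3 (amp u) * wnorm 3 (fun k => ‖x k‖) *
            wnorm 3 (fun k => ‖x k‖) + embConst * wnorm 3 (amp u) * wnorm 3 (fun k => ‖x k‖) *
            wnorm 3 (fun k => ‖x k‖) + embConst * wnorm 3 (amp u) * wnorm 3 (fun k => ‖x k‖) *
            wnorm 3 (fun k => ‖x k‖))) := by
          gcongr
          exacts [y1.2, y2.2, y3.2]
      _ = _ := by unfold transConst; ring

/-- The W^{2,2} estimate, by the same scheme with `kernel_four`. Its constant is `8 · 3 = 24`,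
enlarged to 36 so that one constant serves everywhere. -/
theorem IsSolenoidal.energy_four (hu : IsSolenoidal u) (hU : WSummable 3 (amp u))
    (hx : WSummable 2 fun k => ‖x k‖) {N : ℝ} (hN : 0 ≤ N) :
    |∑' m, min (J m) N ^ 4 * (starRingEnd ℂ (x m) * transport u x m).re| ≤
      transConst * wnorm 3 (amp u) * wnorm 2 (fun k => ‖x k‖) ^ 2 := by
  have n0 : ∀ k, 0 ≤ ‖x k‖ := fun k => norm_nonneg _
  have y1 := young_one_weighted (amp_nonneg u) n0 n0 1 le_rfl hU hx hx
  have y2 := young_two_weighted (amp_nonneg u) n0 n0 0 le_rfl hU hx hx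
  have y3 := young_two_weighted_swap (amp_nonneg u) hu.amp_neg n0 0 le_rfl hU hx
  have hs := summable_pairing (x := x) (y := x) (φ := fun k => min (J k) N ^ 4) hU
    (hx.mono (by norm_num)) (summable_bounded_weight (M := N ^ 4) (s := 0)
      (fun k => by simpa using abs_min_pow_le (J_pos k).le hN 4) (hx.mono (by norm_num)))
  have hsum := ((y1.1.add y2.1).add y3.1).mul_left 8
  refine (hu.energy_le (φ := fun k => min (J k) N ^ 4) hs hsum fun p => ?_).trans ?_
  · have hk := kernel_four (J_pos p.1).le (J_pos p.2).le hN (abs_J_sub_le p.1 p.2)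
    have hp := hu.norm_pairing_le_min x p
    have ha := amp_nonneg u (p.1 - p.2)
    calc _ ≤ |min (J p.1) N ^ 4 - min (J p.2) N ^ 4| *
          (amp u (p.1 - p.2) * min (J p.1) (J p.2) * (‖x p.1‖ * ‖x p.2‖)) := by gcongr
      _ = (|min (J p.1) N ^ 4 - min (J p.2) N ^ 4| * min (J p.1) (J p.2)) *
          (amp u (p.1 - p.2) * (‖x p.1‖ * ‖x p.2‖)) := by ring
      _ ≤ _ := mul_le_mul_of_nonneg_right hk (by positivity)
      _ = _ := by ring
  · rw [tsum_mul_left, (y1.1.add y2.1).tsum_add y3.1, y1.1.tsum_add y2.1]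
    have := Real.pi_pos
    have h0 := mul_nonneg (mul_nonneg embConst_nonneg (wnorm_nonneg 3 (amp u)))
      (sq_nonneg (wnorm 2 (fun k => ‖x k‖)))
    calc _ ≤ Real.pi * (8 * (embConst * wnorm 3 (amp u) * wnorm 2 (fun k => ‖x k‖) *
            wnorm 2 (fun k => ‖x k‖) + embConst * wnorm 3 (amp u) * wnorm 2 (fun k => ‖x k‖) *
            wnorm 2 (fun k => ‖x k‖) + embConst * wnorm 3 (amp u) * wnorm 2 (fun k => ‖x k‖) *
            wnorm 2 (fun k => ‖x k‖))) := by
          gcongr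
          exacts [y1.2, y2.2, y3.2]
      _ = 24 * Real.pi * (embConst * wnorm 3 (amp u) * wnorm 2 (fun k => ‖x k‖) ^ 2) := by ring
      _ ≤ 36 * Real.pi * (embConst * wnorm 3 (amp u) * wnorm 2 (fun k => ‖x k‖) ^ 2) := by
          gcongr; norm_num
      _ = _ := by unfold transConst; ring

/-- A constant weight has zero differences: transport by a divergence free field conserves the L²
norm. -/
theorem IsSolenoidal.energy_zero (hu : IsSolenoidal u) (hU : WSummable 3 (amp u))
    (hx : WSummable 1 fun k => ‖x k‖) :
    ∑' m, (starRingEnd ℂ (x m) * transport u x m).re = 0 := by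
  have hs := summable_pairing (x := x) (y := x) (φ := fun _ => 1) hU hx
    (summable_bounded_weight (M := 1) (s := 0) (fun k => by simp) (hx.mono (by norm_num)))
  have h := hu.energy_le (φ := fun _ => 1) (K := fun _ => 0) hs summable_zero fun p => by simp
  simpa using h

/-- Estimate of a lower order transport term against the `W^{2,2}` energy. -/
theorem source_four (hU : WSummable 3 (amp u)) (hx : WSummable 3 fun k => ‖x k‖)
    (hy : WSummable 2 fun k => ‖y k‖) {N : ℝ} (hN : 0 ≤ N) :
    |∑' m, min (J m) N ^ 4 * (starRingEnd ℂ (y m) * transport u x m).re| ≤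
      transConst * wnorm 3 (amp u) * wnorm 2 (fun k => ‖y k‖) * wnorm 3 (fun k => ‖x k‖) := by
  have n0 : ∀ k, 0 ≤ ‖x k‖ := fun k => norm_nonneg _
  have n1 : ∀ k, 0 ≤ ‖y k‖ := fun k => norm_nonneg _
  have y1 := young_one_weighted (amp_nonneg u) n1 n0 0 (by norm_num) hU hy hx
  have y2 := young_two_weighted (amp_nonneg u) n1 n0 1 le_rfl (hU.mono (show 2 ≤ 3 by norm_num)) hy hx
  have hs := summable_pairing (x := x) (y := y) (φ := fun k => min (J k) N ^ 4) hU
    (hx.mono (by norm_num)) (summable_bounded_weight (M := N ^ 4) (s := 0)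
      (fun k => by simpa using abs_min_pow_le (J_pos k).le hN 4) (hy.mono (by norm_num)))
  have hsum := (y1.1.add y2.1).mul_left 2
  refine (abs_tsum_transport_le (φ := fun k => min (J k) N ^ 4) hs hsum fun p => ?_).trans ?_
  · have hp := norm_pairing_le u x y p
    have ha := amp_nonneg u (p.1 - p.2)
    have j1 := J_pos p.1
    have j2 := J_pos p.2
    have j3 := J_pos (p.1 - p.2)
    have hφ : |min (J p.1) N ^ 4| ≤ J p.1 ^ 4 := by
      rw [abs_of_nonneg (pow_nonneg (le_min j1.le hN) 4)]
      exact pow_le_pow_left₀ (le_min j1.le hN) (min_le_left _ _) 4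
    -- Of the four powers of the weight, two stay on `y`. The other two are distributed between the
    -- velocity and `x`; with the derivative already on `x`, this uses its W^{3,2} norm.
    have hj : J p.1 ^ 2 ≤ 2 * J (p.1 - p.2) ^ 2 + 2 * J p.2 ^ 2 := by
      nlinarith [J_le_add p.1 p.2, sq_nonneg (J (p.1 - p.2) - J p.2),
        pow_le_pow_left₀ j1.le (J_le_add p.1 p.2) 2]
    calc _ ≤ J p.1 ^ 4 * (amp u (p.1 - p.2) * ‖y p.1‖ * (J p.2 ^ 1 * ‖x p.2‖)) := by gcongr
      _ = J p.1 ^ 2 * (J p.1 ^ 2 * (amp u (p.1 - p.2) * ‖y p.1‖ * (J p.2 ^ 1 * ‖x p.2‖))) := by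
          ring
      _ ≤ _ := mul_le_mul_of_nonneg_right hj (by positivity)
      _ = _ := by ring
  · rw [tsum_mul_left, y1.1.tsum_add y2.1]
    have := Real.pi_pos
    have hm := wnorm_mono hU (show 2 ≤ 3 by norm_num)
    have h0 := mul_nonneg (mul_nonneg (mul_nonneg embConst_nonneg (wnorm_nonneg 3 (amp u)))
      (wnorm_nonneg 2 (fun k => ‖y k‖))) (wnorm_nonneg 3 (fun k => ‖x k‖))
    have h1 := embConst_nonneg
    have h2 := wnorm_nonneg 2 (fun k => ‖y k‖)
    have h3 := wnorm_nonneg 3 (fun k => ‖x k‖)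
    calc _ ≤ 2 * Real.pi * (2 * (embConst * wnorm 3 (amp u) * wnorm 2 (fun k => ‖y k‖) *
            wnorm 3 (fun k => ‖x k‖) + embConst * wnorm 3 (amp u) * wnorm 2 (fun k => ‖y k‖) *
            wnorm 3 (fun k => ‖x k‖))) := by
          gcongr
          · exact y1.2
          · exact y2.2.trans (by gcongr)
      _ = 8 * Real.pi * (embConst * wnorm 3 (amp u) * wnorm 2 (fun k => ‖y k‖) *
            wnorm 3 (fun k => ‖x k‖)) := by ring
      _ ≤ 36 * Real.pi * (embConst * wnorm 3 (amp u) * wnorm 2 (fun k => ‖y k‖) *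
            wnorm 3 (fun k => ‖x k‖)) := by gcongr; norm_num
      _ = _ := by unfold transConst; ring

/-- Estimate of a lower order transport term against the `L²` energy. -/
theorem source_zero (hU : WSummable 3 (amp u)) (hx : WSummable 1 fun k => ‖x k‖)
    (hy : WSummable 0 fun k => ‖y k‖) :
    |∑' m, (starRingEnd ℂ (y m) * transport u x m).re| ≤
      transConst * wnorm 3 (amp u) * wnorm 0 (fun k => ‖y k‖) * wnorm 1 (fun k => ‖x k‖) := by
  have n0 : ∀ k, 0 ≤ ‖x k‖ := fun k => norm_nonneg _
  have n1 : ∀ k, 0 ≤ ‖y k‖ := fun k => norm_nonneg _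
  have y1 := young_one_weighted (amp_nonneg u) n1 n0 0 (by norm_num) hU hy hx
  have hs := summable_pairing (x := x) (y := y) (φ := fun _ => 1) hU hx
    (summable_bounded_weight (M := 1) (s := 0) (fun k => by simp) hy)
  have h := abs_tsum_transport_le (φ := fun _ => 1) hs y1.1 fun p => by simpa using norm_pairing_le u x y p
  simp only [one_mul] at h
  have := Real.pi_pos
  have h0 := mul_nonneg (mul_nonneg (mul_nonneg embConst_nonneg (wnorm_nonneg 3 (amp u)))
      (wnorm_nonneg 0 (fun k => ‖y k‖))) (wnorm_nonneg 1 (fun k => ‖x k‖))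
  calc _ ≤ _ := h
    _ ≤ 2 * Real.pi * (embConst * wnorm 3 (amp u) * wnorm 0 (fun k => ‖y k‖) *
        wnorm 1 (fun k => ‖x k‖)) := by gcongr; exact y1.2
    _ ≤ 36 * Real.pi * (embConst * wnorm 3 (amp u) * wnorm 0 (fun k => ‖y k‖) *
        wnorm 1 (fun k => ‖x k‖)) := by gcongr; norm_num
    _ = _ := by unfold transConst; ring

end Bounds

/-! ### Fourier coefficients of functions, products, weak derivatives and weak divergences -/

open UnitAddTorus

/-- Fourier coefficients with respect to Lebesgue measure. -/
noncomputable def cfc (f : Torus → ℂ) (k : Freq) : ℂ := ∫ x, mFourier (-k) x * f x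

/-- Fourier coefficients of real functions. -/
noncomputable def fc (v : Torus → ℝ) (k : Freq) : ℂ := cfc (fun x => (v x : ℂ)) k

theorem volume_torus_eq :
    (volume : Measure Torus) = Measure.pi fun _ : Fin 2 => (AddCircle.haarAddCircle (T := (1 : ℝ))) := by
  have h : (volume : Measure UnitAddCircle) = AddCircle.haarAddCircle := by
    rw [AddCircle.volume_eq_smul_haarAddCircle]; simp
  change Measure.pi (fun _ : Fin 2 => (volume : Measure UnitAddCircle)) = _
  rw [h]

/-- The measure is a variable so that its identification with the product Haar measure can be
substituted throughout. -/
theorem parseval_aux {μ : Measure Torus}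
    (hμ : μ = Measure.pi fun _ : Fin 2 => (AddCircle.haarAddCircle (T := (1 : ℝ))))
    {f g : Torus → ℂ} (hf : MemLp f 2 μ) (hg : MemLp g 2 μ) :
    HasSum (fun k : Freq => starRingEnd ℂ (∫ x, mFourier (-k) x * f x ∂μ) *
      ∫ x, mFourier (-k) x * g x ∂μ) (∫ x, starRingEnd ℂ (f x) * g x ∂μ) := by
  subst hμ
  have h := hasSum_prod_mFourierCoeff (hf.toLp f) (hg.toLp g)
  have e : ∀ {p : Torus → ℂ} (hp : MemLp p 2 (Measure.pi fun _ : Fin 2 => (AddCircle.haarAddCircle (T := (1 : ℝ))))) (k : Freq),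
      mFourierCoeff (hp.toLp p) k = ∫ x, mFourier (-k) x * p x ∂(Measure.pi fun _ : Fin 2 => (AddCircle.haarAddCircle (T := (1 : ℝ)))) := by
    intro p hp k
    refine integral_congr_ae ?_
    filter_upwards [hp.coeFn_toLp] with x hx
    rw [hx, smul_eq_mul]
  simp only [e] at h
  convert! h using 1
  refine integral_congr_ae ?_
  filter_upwards [hf.coeFn_toLp, hg.coeFn_toLp] with x hx hx'
  rw [hx, hx']

theorem parseval {f g : Torus → ℂ} (hf : MemLp f 2) (hg : MemLp g 2) :
    HasSum (fun k => starRingEnd ℂ (cfc f k) * cfc g k) (∫ x, starRingEnd ℂ (f x) * g x) :=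
  parseval_aux volume_torus_eq hf hg

theorem norm_mFourier_apply (k : Freq) (x : Torus) : ‖mFourier k x‖ = 1 := by
  simp [mFourier, fourier_apply, Circle.norm_coe]

theorem memLp_mFourier_mul {f : Torus → ℂ} {p : ℝ≥0∞} (hf : MemLp f p) (k : Freq) :
    MemLp (fun x => mFourier k x * f x) p := by
  refine hf.of_le ((mFourier k).continuous.aestronglyMeasurable.mul hf.1) (ae_of_all _ fun x => ?_)
  rw [norm_mul, norm_mFourier_apply, one_mul]

theorem memLp_ofReal {v : Torus → ℝ} {p : ℝ≥0∞} (hv : MemLp v p) :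
    MemLp (fun x => (v x : ℂ)) p := hv.ofReal

theorem fc_neg (v : Torus → ℝ) (k : Freq) : fc v (-k) = starRingEnd ℂ (fc v k) := by
  rw [fc, fc, cfc, cfc, ← integral_conj]
  refine integral_congr_ae (ae_of_all _ fun x => ?_)
  simp [mFourier_neg]

theorem hasSum_fc {v w : Torus → ℝ} (hv : MemLp v 2) (hw : MemLp w 2) :
    HasSum (fun k => starRingEnd ℂ (fc v k) * fc w k) ((∫ x, v x * w x : ℝ) : ℂ) := by
  have h := parseval (memLp_ofReal hv) (memLp_ofReal hw)
  convert! h using 1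
  rw [← integral_complex_ofReal]
  simp

theorem hasSum_norm_sq_fc {v : Torus → ℝ} (hv : MemLp v 2) :
    HasSum (fun k => ‖fc v k‖ ^ 2) (∫ x, v x ^ 2) := by
  have h := Complex.hasSum_re (hasSum_fc hv hv)
  simp only [Complex.ofReal_re, ← sq] at h
  convert! h using 2 with k
  rw [← Complex.normSq_eq_conj_mul_self, Complex.ofReal_re, Complex.normSq_eq_norm_sq]

/-- Fourier coefficients of a product. -/
theorem hasSum_fc_mul {v w : Torus → ℝ} (hv : MemLp v 2) (hw : MemLp w 2) (m : Freq) :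
    HasSum (fun l => fc v (m - l) * fc w l) (fc (fun x => v x * w x) m) := by
  -- The `m`-th coefficient of `v w` is the inner product of `e_m v` with `w`, and modulation by
  -- `e_m` shifts the coefficients of `v`. Thus L² factors suffice.
  have h := parseval (memLp_mFourier_mul (memLp_ofReal hv) m) (memLp_ofReal hw)
  have e1 : fc (fun x => v x * w x) m =
      ∫ x, starRingEnd ℂ (mFourier m x * (v x : ℂ)) * (w x : ℂ) := by
    refine integral_congr_ae (ae_of_all _ fun x => ?_)
    simp [mFourier_neg, mul_assoc]
  rw [e1]
  refine h.congr_fun fun l => ?_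
  congr 1
  rw [← neg_sub l m, fc_neg]
  congr 1
  refine integral_congr_ae (ae_of_all _ fun x => ?_)
  dsimp only
  rw [neg_sub, sub_eq_add_neg, add_comm m, mFourier_add, mul_assoc]

/-- Real trigonometric monomials. -/
noncomputable def trig (c : ℂ) (k : Freq) : Torus → ℝ := fun x => (c * mFourier k x).re

theorem mFourier_coe (k : Freq) (y : Fin 2 → ℝ) :
    mFourier k (fun i => (y i : UnitAddCircle)) =
      Complex.exp (2 * Real.pi * Complex.I * k 0 * y 0) *
        Complex.exp (2 * Real.pi * Complex.I * k 1 * y 1) := by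
  simp [mFourier, Fin.prod_univ_two]

theorem isTest_trig (c : ℂ) (k : Freq) : IsTest (trig c k) := by
  unfold IsTest trig
  simp only [mFourier_coe]
  have h0 : ∀ i : Fin 2, ContDiff ℝ ((⊤ : ℕ∞) : WithTop ℕ∞) fun y : Fin 2 → ℝ => (y i : ℂ) := fun i =>
    Complex.ofRealCLM.contDiff.comp (contDiff_apply ℝ ℝ i)
  exact Complex.reCLM.contDiff.comp (contDiff_const.mul
    ((contDiff_const.mul (h0 0)).cexp.mul (contDiff_const.mul (h0 1)).cexp))

theorem mFourier_add_single (k : Freq) (x : Torus) (j : Fin 2) (s : ℝ) :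
    mFourier k (x + Pi.single j (s : UnitAddCircle)) =
      mFourier k x * Complex.exp (2 * Real.pi * Complex.I * k j * s) := by
  have h : ∀ (n : ℤ) (a b : UnitAddCircle), fourier n (a + b) = fourier n a * fourier n b := by
    intro n a b
    simp [fourier_apply, smul_add, AddCircle.toCircle_add]
  have hs : ∀ n : ℤ, fourier n (s : UnitAddCircle) =
      Complex.exp (2 * Real.pi * Complex.I * n * s) := fun n => by
    rw [fourier_coe_apply]; simp
  simp only [mFourier, ContinuousMap.coe_mk, Fin.prod_univ_two, Pi.add_apply, h]
  fin_cases j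
  · simp only [Fin.zero_eta, Pi.single_eq_same, hs, ne_eq, one_ne_zero, not_false_eq_true,
      Pi.single_eq_of_ne, fourier_eval_zero]
    ring
  · simp only [Fin.mk_one, Pi.single_eq_same, hs, ne_eq, zero_ne_one, not_false_eq_true,
      Pi.single_eq_of_ne, fourier_eval_zero]
    ring

theorem pderiv_trig (j : Fin 2) (c : ℂ) (k : Freq) :
    pderiv j (trig c k) = trig (2 * Real.pi * Complex.I * k j * c) k := by
  ext x
  unfold pderiv trig
  simp only [mFourier_add_single]
  have h1 : HasDerivAt (fun s : ℝ => Complex.exp (2 * Real.pi * Complex.I * k j * s))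
      (2 * Real.pi * Complex.I * k j) 0 := by
    have h := ((Complex.ofRealCLM.hasDerivAt (x := (0 : ℝ))).const_mul
      (2 * Real.pi * Complex.I * (k j : ℂ))).cexp
    simpa using h
  have h2 := (h1.const_mul (c * mFourier k x))
  have h3 := (Complex.reCLM.hasFDerivAt.comp_hasDerivAt (0 : ℝ) h2)
  simp only [Complex.reCLM_apply] at h3
  have h4 : (fun s : ℝ => (c * (mFourier k x * Complex.exp (2 * Real.pi * Complex.I * k j * s))).re) =
      Complex.reCLM ∘ fun s : ℝ => c * mFourier k x * Complex.exp (2 * Real.pi * Complex.I * k j * s) := by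
    ext s
    simp [mul_assoc]
  rw [h4, h3.deriv]
  congr 1
  ring

/-- The Fourier symbol of `∂^β`. -/
noncomputable def symb (β : ℕ × ℕ) (k : Freq) : ℂ :=
  (2 * Real.pi * Complex.I * k 0) ^ β.1 * (2 * Real.pi * Complex.I * k 1) ^ β.2

theorem mderiv_trig (β : ℕ × ℕ) (c : ℂ) (k : Freq) :
    mderiv β (trig c k) = trig (symb β k * c) k := by
  have h : ∀ (j : Fin 2) (n : ℕ) (c : ℂ), (pderiv j)^[n] (trig c k) =
      trig ((2 * Real.pi * Complex.I * k j) ^ n * c) k := by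
    intro j n
    induction n with
    | zero => simp
    | succ n ih => intro c; rw [Function.iterate_succ_apply, pderiv_trig, ih]; congr 1; ring
  rw [mderiv, h, h, symb]
  congr 1
  ring

theorem integral_mul_trig {v : Torus → ℝ} (hv : Integrable v) (c : ℂ) (k : Freq) :
    ∫ x, v x * trig c k x = (c * fc v (-k)).re := by
  have hi : Integrable fun x => c * (mFourier (- -k) x * (v x : ℂ)) := by
    have := memLp_mFourier_mul (memLp_ofReal (memLp_one_iff_integrable.2 hv)) (- -k)
    exact (memLp_one_iff_integrable.1 this).const_mul c
  rw [fc, cfc, ← integral_const_mul]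
  have := Complex.reCLM.integral_comp_comm hi
  simp only [Complex.reCLM_apply] at this
  rw [← this]
  refine integral_congr_ae (ae_of_all _ fun x => ?_)
  simp only [trig, neg_neg]
  rw [← mul_assoc, mul_comm _ (v x : ℂ), Complex.re_ofReal_mul]

/-- Test functions are real, so an identity tested with all `Re (c e_k)` only yields real parts.
Letting `c` vary recovers the complex coefficient. -/
theorem eq_of_forall_re {a b : ℂ} (h : ∀ c : ℂ, (c * a).re = (c * b).re) : a = b := by
  have h1 := h 1
  have h2 := h (-Complex.I)
  simp at h1 h2
  exact Complex.ext h1 h2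

theorem symb_neg (β : ℕ × ℕ) (k : Freq) : symb β (-k) = (-1) ^ (β.1 + β.2) * symb β k := by
  simp only [symb, Pi.neg_apply, Int.cast_neg, mul_neg]
  rw [neg_pow, neg_pow (2 * Real.pi * Complex.I * (k 1 : ℂ)), pow_add]
  ring

/-- Fourier coefficients of weak derivatives. -/
theorem fc_weakDeriv {β : ℕ × ℕ} {v w : Torus → ℝ} (h : IsWeakDeriv β v w) (k : Freq) :
    fc w k = symb β k * fc v k := by
  obtain ⟨hv, hw, h⟩ := h
  refine eq_of_forall_re fun c => ?_
  -- Testing at `-k` produces the coefficient at `k`; the sign in `symb_neg` cancels the sign in the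
  -- definition of weak derivatives.
  have := h _ (isTest_trig c (-k))
  rw [mderiv_trig, integral_mul_trig hv, integral_mul_trig hw, neg_neg, symb_neg] at this
  have e : ((-1 : ℂ) ^ (β.1 + β.2)) = (((-1 : ℝ) ^ (β.1 + β.2) : ℝ) : ℂ) := by simp
  rw [e, mul_assoc, mul_assoc, Complex.re_ofReal_mul] at this
  have h1 := mul_left_cancel₀ (pow_ne_zero _ (by norm_num : (-1 : ℝ) ≠ 0)) this
  rw [← h1]
  congr 1
  ring

/-- Fourier coefficients of a weak divergence. -/
theorem fc_weakDiv {g : Fin 2 → Torus → ℝ} {w : Torus → ℝ} (h : IsWeakDiv g w) (k : Freq) :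
    fc w k = 2 * Real.pi * Complex.I * (k 0 * fc (g 0) k + k 1 * fc (g 1) k) := by
  obtain ⟨hg, hw, h⟩ := h
  refine eq_of_forall_re fun c => ?_
  have := h _ (isTest_trig c (-k))
  have hb : ∀ (i : Fin 2) (c : ℂ), Integrable fun x => g i x * trig c (-k) x := fun i c =>
    (hg i).mul_bdd (c := ‖c‖) (by
      have : Continuous (trig c (-k)) := by unfold trig; fun_prop
      exact this.aestronglyMeasurable) (ae_of_all _ fun x => by
      rw [trig, Real.norm_eq_abs]
      refine (Complex.abs_re_le_norm _).trans ?_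
      rw [norm_mul, norm_mFourier_apply, mul_one])
  rw [pderiv_trig, pderiv_trig, integral_add (hb _ _) (hb _ _), integral_mul_trig (hg 0),
    integral_mul_trig (hg 1), integral_mul_trig hw, neg_neg] at this
  rw [eq_comm, neg_eq_iff_eq_neg] at this
  rw [this, ← Complex.add_re, ← Complex.neg_re]
  congr 1
  simp
  ring

theorem memLp_L2 (v : L2) : MemLp v 2 := Lp.memLp v

theorem integrable_L2 (v : L2) : Integrable v := (memLp_L2 v).integrable (by norm_num)

theorem fc_congr {v w : Torus → ℝ} (h : v =ᵐ[volume] w) (k : Freq) : fc v k = fc w k := by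
  refine integral_congr_ae ?_
  filter_upwards [h] with x hx
  rw [hx]

theorem integrable_mFourier_mul {v : Torus → ℝ} (hv : Integrable v) (k : Freq) :
    Integrable fun x => mFourier k x * (v x : ℂ) :=
  memLp_one_iff_integrable.1
    (memLp_mFourier_mul (memLp_ofReal (memLp_one_iff_integrable.2 hv)) k)

theorem fc_sub {v w : Torus → ℝ} (hv : Integrable v) (hw : Integrable w) (k : Freq) :
    fc (fun x => v x - w x) k = fc v k - fc w k := by
  rw [fc, fc, fc, cfc, cfc, cfc,
    ← integral_sub (integrable_mFourier_mul hv _) (integrable_mFourier_mul hw _)]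
  refine integral_congr_ae (ae_of_all _ fun x => ?_)
  push_cast
  ring

theorem fc_fun_neg (v : Torus → ℝ) (k : Freq) : fc (fun x => - v x) k = - fc v k := by
  simp [fc, cfc, integral_neg]

theorem fc_L2_sub (v w : L2) (k : Freq) : fc (v - w : L2) k = fc v k - fc w k := by
  rw [← fc_sub (integrable_L2 v) (integrable_L2 w)]
  exact fc_congr (Lp.coeFn_sub v w) k

theorem fc_L2_add (v w : L2) (k : Freq) : fc (v + w : L2) k = fc v k + fc w k := by
  have h : v = (v + w) - w := by abel
  conv_rhs => rw [h, fc_L2_sub]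
  ring

theorem fc_L2_smul (c : ℝ) (v : L2) (k : Freq) : fc (c • v : L2) k = c • fc v k := by
  rw [fc_congr (Lp.coeFn_smul c v) k, fc, fc, cfc, cfc, ← integral_smul]
  refine integral_congr_ae (ae_of_all _ fun x => ?_)
  simp
  ring

theorem norm_sq_L2 (v : L2) : ‖v‖ ^ 2 = ∫ x, v x ^ 2 := by
  have h := L2.inner_def (𝕜 := ℝ) v v
  rw [real_inner_self_eq_norm_sq] at h
  rw [h]
  refine integral_congr_ae (ae_of_all _ fun x => ?_)
  simp [sq]

theorem hasSum_norm_sq_L2 (v : L2) : HasSum (fun k => ‖fc v k‖ ^ 2) (‖v‖ ^ 2) := by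
  rw [norm_sq_L2]
  exact hasSum_norm_sq_fc (memLp_L2 v)

theorem norm_fc_le (v : L2) (k : Freq) : ‖fc v k‖ ≤ ‖v‖ := by
  refine le_of_sq_le_sq ?_ (norm_nonneg _)
  exact le_hasSum (hasSum_norm_sq_L2 v) k fun _ _ => sq_nonneg _

theorem wSummable_zero (v : L2) : WSummable 0 fun k => ‖fc v k‖ := by
  simpa [WSummable] using (hasSum_norm_sq_L2 v).summable

theorem wnorm_zero_L2 (v : L2) : wnorm 0 (fun k => ‖fc v k‖) = ‖v‖ := by
  rw [wnorm_zero, (hasSum_norm_sq_L2 v).tsum_eq, Real.sqrt_sq (norm_nonneg _)]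

/-- The Fourier coefficient as a continuous linear functional. -/
noncomputable def fcCLM (k : Freq) : L2 →L[ℝ] ℂ :=
  LinearMap.mkContinuous
    { toFun := fun v => fc v k
      map_add' := fun v w => fc_L2_add v w k
      map_smul' := fun c v => fc_L2_smul c v k } 1 fun v => by
      simpa using norm_fc_le v k

theorem fcCLM_apply (k : Freq) (v : L2) : fcCLM k v = fc v k := rfl

/-! ### The velocity: incompressibility and the gain of three derivatives -/

section Velocity

/-- The size of the frequency squared. -/
noncomputable def freqSq (k : Freq) : ℝ := (k 0 : ℝ) ^ 2 + (k 1 : ℝ) ^ 2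

theorem freqSq_nonneg (k : Freq) : 0 ≤ freqSq k := by unfold freqSq; positivity

theorem J_sq_le (k : Freq) : J k ^ 2 ≤ 3 * (1 + freqSq k) := by
  unfold J freqSq
  rw [← sq_abs (k 0 : ℝ), ← sq_abs (k 1 : ℝ)]
  nlinarith [sq_nonneg (1 - |(k 0 : ℝ)|), sq_nonneg (1 - |(k 1 : ℝ)|),
    sq_nonneg (|(k 0 : ℝ)| - |(k 1 : ℝ)|)]

theorem one_add_freqSq_le (k : Freq) : 1 + freqSq k ≤ J k ^ 2 := by
  unfold J freqSq
  rw [← sq_abs (k 0 : ℝ), ← sq_abs (k 1 : ℝ)]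
  nlinarith [abs_nonneg (k 0 : ℝ), abs_nonneg (k 1 : ℝ),
    mul_nonneg (abs_nonneg (k 0 : ℝ)) (abs_nonneg (k 1 : ℝ))]

theorem lap_trig (c : ℂ) (k : Freq) :
    lap (trig c k) = trig (((-(4 * Real.pi ^ 2 * freqSq k) : ℝ) : ℂ) * c) k := by
  ext x
  simp only [lap, mderiv_trig, trig, ← Complex.add_re]
  congr 1
  simp only [symb, freqSq]
  push_cast
  ring_nf
  simp
  ring

theorem trig_sub (a b : ℂ) (α : ℝ) (k : Freq) :
    (fun z => trig a k z - α * trig b k z) = trig (a - α * b) k := by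
  ext x
  simp only [trig, sub_mul, Complex.sub_re, mul_assoc, Complex.re_ofReal_mul]

/-- The Fourier symbol of `(1 - Δ)(1 - α Δ)`. -/
noncomputable def ellSymb (α : ℝ) (k : Freq) : ℝ :=
  (1 + 4 * Real.pi ^ 2 * freqSq k) * (1 + α * (4 * Real.pi ^ 2 * freqSq k))

theorem ellipticOp_trig (α : ℝ) (c : ℂ) (k : Freq) :
    ellipticOp α (trig c k) = trig (-(ellSymb α k : ℂ) * c) k := by
  ext x
  unfold ellipticOp
  rw [lap_trig, trig_sub, lap_trig]
  have h := congrFun (trig_sub c (((-(4 * Real.pi ^ 2 * freqSq k) : ℝ) : ℂ) * c) α k) x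
  rw [h]
  simp only [trig, ← Complex.sub_re]
  congr 1
  simp only [ellSymb]
  push_cast
  ring

theorem freqSq_neg (k : Freq) : freqSq (-k) = freqSq k := by simp [freqSq]

/-- Fourier description of the velocity. -/
theorem IsVelocity.exists_stream {α : ℝ} {f ω : L2} {u : Fin 2 → L2} (h : IsVelocity α f ω u) :
    ∃ ψ : Freq → ℂ, ∀ k, -(ellSymb α k : ℂ) * ψ k = fc ω k - fc f k ∧
      fc (u 0) k = -(2 * Real.pi * Complex.I * k 1 * ψ k) ∧
      fc (u 1) k = 2 * Real.pi * Complex.I * k 0 * ψ k := by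
  obtain ⟨ψ, h, h0, h1⟩ := h
  refine ⟨fc ψ, fun k => ⟨eq_of_forall_re fun c => ?_, ?_, ?_⟩⟩
  · have := h _ (isTest_trig c (-k))
    rw [ellipticOp_trig, integral_mul_trig (integrable_L2 ψ),
      integral_mul_trig (v := fun x => ω x - f x) ((integrable_L2 ω).sub (integrable_L2 f)), neg_neg,
      fc_sub (integrable_L2 ω) (integrable_L2 f)] at this
    rw [← this, ellSymb, ellSymb, freqSq_neg]
    congr 1
    ring
  · have := fc_weakDeriv h0 k
    rw [fc_fun_neg] at this
    rw [← neg_neg (fc (u 0) k), this]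
    simp [symb]
  · rw [fc_weakDeriv h1 k]
    simp [symb]

/-- Fourier coefficients of a vector field. -/
noncomputable def vfc (u : Fin 2 → L2) : Fin 2 → Freq → ℂ := fun i => fc (u i)

theorem IsVelocity.isSolenoidal {α : ℝ} {f ω : L2} {u : Fin 2 → L2} (h : IsVelocity α f ω u) :
    IsSolenoidal (vfc u) := by
  obtain ⟨ψ, hψ⟩ := h.exists_stream
  refine ⟨fun k => ?_, fun i k => fc_neg _ k⟩
  rw [dotf, vfc, vfc, (hψ k).2.1, (hψ k).2.2]
  ring

/-- The constant of the elliptic estimate. -/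
noncomputable def ellConst (α : ℝ) : ℝ := 18 * Real.pi / min 1 α

theorem ellConst_nonneg {α : ℝ} (hα : 0 < α) : 0 ≤ ellConst α := by
  have := Real.pi_pos
  have : 0 < min 1 α := lt_min one_pos hα
  unfold ellConst
  positivity

/-- Ellipticity of order four. With `X = 4π²|k|²`, `J²` is at most `3(1 + X)`, and `1 + αX` is at
least `min 1 α` times `1 + X`; the degeneration as `α → 0` is visible here. -/
theorem J_four_le {α : ℝ} (hα : 0 < α) (k : Freq) : J k ^ 4 * min 1 α ≤ 9 * ellSymb α k := by
  have h1 := J_sq_le k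
  have h2 := freqSq_nonneg k
  have hπ : 1 ≤ 4 * Real.pi ^ 2 := by nlinarith [Real.pi_gt_three]
  have h3 : freqSq k ≤ 4 * Real.pi ^ 2 * freqSq k := le_mul_of_one_le_left h2 hπ
  set X := 4 * Real.pi ^ 2 * freqSq k with hX
  have hX0 : 0 ≤ X := h2.trans h3
  have hm : 0 < min 1 α := lt_min one_pos hα
  have h4 : J k ^ 4 ≤ 9 * (1 + X) ^ 2 := by
    have := pow_le_pow_left₀ (sq_nonneg (J k)) (h1.trans (by linarith : _ ≤ 3 * (1 + X))) 2
    nlinarith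
  have h5 : min 1 α * (1 + X) ≤ 1 + α * X := by
    have ha := min_le_left 1 α
    have hb := mul_le_mul_of_nonneg_right (min_le_right 1 α) hX0
    linarith
  calc _ ≤ 9 * (1 + X) ^ 2 * min 1 α := by gcongr
    _ = 9 * (1 + X) * (min 1 α * (1 + X)) := by ring
    _ ≤ 9 * (1 + X) * (1 + α * X) := by gcongr
    _ = _ := by rw [ellSymb, ← hX]; ring

/-- Inverting the elliptic operator gains four powers of the frequency and `∇^⊥` spends one. The
constant `18π` is the `9` of `J_four_le` times the `2π` of one derivative. -/
theorem IsVelocity.amp_le {α : ℝ} (hα : 0 < α) {f ω : L2} {u : Fin 2 → L2}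
    (h : IsVelocity α f ω u) (k : Freq) :
    J k ^ 3 * amp (vfc u) k ≤ ellConst α * ‖fc (ω - f : L2) k‖ := by
  obtain ⟨ψ, hψ⟩ := h.exists_stream
  have hm : 0 < min 1 α := lt_min one_pos hα
  have he : 0 ≤ ellSymb α k := by
    have := J_four_le hα k
    have : 0 ≤ J k ^ 4 * min 1 α := by have := J_pos k; positivity
    linarith
  have hπ := Real.pi_pos
  have hJ := J_pos k
  have h1 : ‖fc (ω - f : L2) k‖ = ellSymb α k * ‖ψ k‖ := by
    rw [fc_L2_sub, ← (hψ k).1, norm_mul, norm_neg, Complex.norm_real, Real.norm_of_nonneg he]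
  have h2 : amp (vfc u) k ≤ 2 * Real.pi * J k * ‖ψ k‖ := by
    rw [amp, vfc, vfc, (hψ k).2.1, (hψ k).2.2]
    simp only [norm_neg, norm_mul, Complex.norm_intCast, Complex.norm_real, Complex.norm_I,
      Real.norm_of_nonneg hπ.le, Complex.norm_ofNat, J]
    have : 0 ≤ 2 * Real.pi * ‖ψ k‖ := by positivity
    nlinarith
  rw [h1, ellConst, div_mul_eq_mul_div, le_div_iff₀ hm]
  have h4 := J_four_le hα k
  calc _ ≤ J k ^ 3 * (2 * Real.pi * J k * ‖ψ k‖) * min 1 α := by gcongr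
    _ = 2 * Real.pi * ‖ψ k‖ * (J k ^ 4 * min 1 α) := by ring
    _ ≤ 2 * Real.pi * ‖ψ k‖ * (9 * ellSymb α k) := by gcongr
    _ = _ := by ring

theorem IsVelocity.wSummable {α : ℝ} (hα : 0 < α) {f ω : L2} {u : Fin 2 → L2}
    (h : IsVelocity α f ω u) : WSummable 3 (amp (vfc u)) ∧
      wnorm 3 (amp (vfc u)) ≤ ellConst α * (‖ω‖ + ‖f‖) := by
  have hs := hasSum_norm_sq_L2 (ω - f)
  have hc := ellConst_nonneg hα
  have hle : ∀ k, (J k ^ 3 * amp (vfc u) k) ^ 2 ≤ ellConst α ^ 2 * ‖fc (ω - f : L2) k‖ ^ 2 := by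
    intro k
    rw [← mul_pow]
    have := amp_nonneg (vfc u) k
    have := J_pos k
    exact pow_le_pow_left₀ (by positivity) (h.amp_le hα k) 2
  have h1 : WSummable 3 (amp (vfc u)) :=
    Summable.of_nonneg_of_le (fun _ => sq_nonneg _) hle (hs.summable.mul_left _)
  refine ⟨h1, ?_⟩
  rw [wnorm]
  refine (Real.sqrt_le_sqrt (h1.tsum_le_tsum hle (hs.summable.mul_left _))).trans ?_
  rw [tsum_mul_left, hs.tsum_eq, ← mul_pow, Real.sqrt_sq (by positivity)]
  exact mul_le_mul_of_nonneg_left (norm_sub_le _ _) hc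

end Velocity

/-! ### Comparison of Sobolev norms with weighted norms of Fourier coefficients -/

section Sobolev

variable {s : ℕ} {v : L2}

theorem weakDeriv_le_sobolevENorm {s : ℕ} {v : Torus → ℝ} {β : ℕ × ℕ} (hβ : β.1 + β.2 ≤ s) :
    (⨅ (w : Torus → ℝ) (_ : IsWeakDeriv β v w), eLpNorm w 2 volume) ≤ sobolevENorm s 2 v := by
  unfold sobolevENorm
  refine le_trans ?_ (Finset.single_le_sum (fun _ _ => zero_le)
    (Finset.mem_range.2 (Nat.lt_succ_of_le hβ)))
  exact Finset.single_le_sum (f := fun β => ⨅ (w : Torus → ℝ) (_ : IsWeakDeriv β v w),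
    eLpNorm w 2 volume) (fun _ _ => zero_le) (Finset.HasAntidiagonal.mem_antidiagonal.2 rfl)

theorem exists_weakDeriv {s : ℕ} {v : Torus → ℝ} (h : sobolevENorm s 2 v < ∞) {β : ℕ × ℕ}
    (hβ : β.1 + β.2 ≤ s) : ∃ w, IsWeakDeriv β v w ∧ MemLp w 2 := by
  have h1 := (weakDeriv_le_sobolevENorm (v := v) hβ).trans_lt h
  simp only [iInf_lt_iff] at h1
  obtain ⟨w, hw, hlt⟩ := h1
  exact ⟨w, hw, hw.2.1.1, hlt⟩

theorem eLpNorm_eq_sqrt {w : Torus → ℝ} (hw : MemLp w 2) :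
    eLpNorm w 2 volume = ENNReal.ofReal (√(∑' k, ‖fc w k‖ ^ 2)) := by
  rw [(hasSum_norm_sq_fc hw).tsum_eq]
  have h := norm_sq_L2 (hw.toLp w)
  have h2 : ∫ x, (hw.toLp w) x ^ 2 = ∫ x, w x ^ 2 := by
    refine integral_congr_ae ?_
    filter_upwards [hw.coeFn_toLp] with x hx
    rw [hx]
  rw [← h2, ← h, Real.sqrt_sq (norm_nonneg _), Lp.norm_toLp, ENNReal.ofReal_toReal hw.2.ne]

/-- All weak derivatives for a given `β` have the same Fourier coefficients, so by Parseval the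
infimum is over equal values, apart from any infinite ones. -/
theorem summable_symb {v : Torus → ℝ} (h : sobolevENorm s 2 v < ∞) {β : ℕ × ℕ}
    (hβ : β.1 + β.2 ≤ s) :
    Summable (fun k => (‖symb β k‖ * ‖fc v k‖) ^ 2) ∧
      (⨅ (w : Torus → ℝ) (_ : IsWeakDeriv β v w), eLpNorm w 2 volume) =
        ENNReal.ofReal (√(∑' k, (‖symb β k‖ * ‖fc v k‖) ^ 2)) := by
  obtain ⟨w, hw, hw2⟩ := exists_weakDeriv h hβ
  have e : ∀ {w}, IsWeakDeriv β v w → (fun k => ‖fc w k‖ ^ 2) =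
      fun k => (‖symb β k‖ * ‖fc v k‖) ^ 2 := fun hw => by
    ext k
    rw [fc_weakDeriv hw, norm_mul]
  refine ⟨by rw [← e hw]; exact (hasSum_norm_sq_fc hw2).summable, le_antisymm ?_ ?_⟩
  · refine (iInf₂_le w hw).trans_eq ?_
    rw [eLpNorm_eq_sqrt hw2, e hw]
  · refine le_iInf₂ fun w' hw' => ?_
    by_cases hfin : eLpNorm w' 2 volume = ∞
    · rw [hfin]; exact le_top
    · rw [eLpNorm_eq_sqrt ⟨hw'.2.1.1, lt_top_iff_ne_top.2 hfin⟩, e hw']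

theorem sqrt_symb_le {v : Torus → ℝ} (h : sobolevENorm s 2 v < ∞) {β : ℕ × ℕ}
    (hβ : β.1 + β.2 ≤ s) :
    ∑' k, (‖symb β k‖ * ‖fc v k‖) ^ 2 ≤ (sobolevENorm s 2 v).toReal ^ 2 := by
  have h1 := weakDeriv_le_sobolevENorm (v := v) hβ
  rw [(summable_symb h hβ).2] at h1
  have h2 := (ENNReal.ofReal_le_iff_le_toReal h.ne).1 h1
  exact (Real.sqrt_le_left ENNReal.toReal_nonneg).1 h2

theorem norm_symb (β : ℕ × ℕ) (k : Freq) :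
    ‖symb β k‖ = (2 * Real.pi * |(k 0 : ℝ)|) ^ β.1 * (2 * Real.pi * |(k 1 : ℝ)|) ^ β.2 := by
  simp [symb, abs_of_pos Real.pi_pos]

theorem norm_symb_le {β : ℕ × ℕ} (hβ : β.1 + β.2 ≤ s) (k : Freq) :
    ‖symb β k‖ ≤ (2 * Real.pi) ^ s * J k ^ s := by
  have hπ : 1 ≤ 2 * Real.pi := by linarith [Real.pi_gt_three]
  have h1 : 1 ≤ 2 * Real.pi * J k := one_le_mul_of_one_le_of_one_le hπ (one_le_J k)
  have h0 := abs_le_J k 0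
  have h1' := abs_le_J k 1
  rw [norm_symb, ← mul_pow]
  calc _ ≤ (2 * Real.pi * J k) ^ β.1 * (2 * Real.pi * J k) ^ β.2 := by gcongr
    _ = (2 * Real.pi * J k) ^ (β.1 + β.2) := by rw [pow_add]
    _ ≤ _ := pow_le_pow_right₀ h1 hβ

/-- `J` is at most three times the largest of `1`, `|k₀|`, `|k₁|`, so no derivatives are needed
besides order zero and the pure ones of order `s`. -/
theorem J_pow_le (s : ℕ) (k : Freq) :
    (J k ^ s) ^ 2 ≤ 9 ^ s * (‖symb (0, 0) k‖ ^ 2 + ‖symb (s, 0) k‖ ^ 2 + ‖symb (0, s) k‖ ^ 2) := by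
  have hπ : 1 ≤ 2 * Real.pi := by linarith [Real.pi_gt_three]
  simp only [norm_symb, pow_zero, one_mul, mul_one]
  have key : ∀ a : ℝ, 0 ≤ a → a ≤ 2 * Real.pi * a := fun a ha => le_mul_of_one_le_left ha hπ
  set a := |(k 0 : ℝ)| with ha
  set b := |(k 1 : ℝ)| with hb
  have ha0 : 0 ≤ a := abs_nonneg _
  have hb0 : 0 ≤ b := abs_nonneg _
  set A := (2 * Real.pi * a) ^ s
  set B := (2 * Real.pi * b) ^ s
  have hA : a ^ s ≤ A := pow_le_pow_left₀ ha0 (key a ha0) s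
  have hB : b ^ s ≤ B := pow_le_pow_left₀ hb0 (key b hb0) s
  have main : ∀ M : ℝ, 0 ≤ M → J k ≤ 3 * M → (J k ^ s) ^ 2 ≤ 9 ^ s * (M ^ s) ^ 2 := by
    intro M hM h
    have h9 : (9 : ℝ) = 3 ^ 2 := by norm_num
    rw [h9, ← pow_mul, ← pow_mul, ← pow_mul, mul_comm s 2, ← mul_pow]
    exact pow_le_pow_left₀ (J_pos k).le h _
  have hJ : J k = 1 + a + b := rfl
  have hsq : ∀ x y : ℝ, 0 ≤ x → x ≤ y → x ^ 2 ≤ y ^ 2 := fun x y hx h => pow_le_pow_left₀ hx h 2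
  rcases le_total a 1 with h1 | h1 <;> rcases le_total b 1 with h2 | h2
  · refine (main 1 zero_le_one (by linarith)).trans ?_
    gcongr
    rw [one_pow]
    nlinarith [sq_nonneg A, sq_nonneg B]
  · refine (main b hb0 (by linarith)).trans ?_
    gcongr
    nlinarith [sq_nonneg A, hsq _ _ (by positivity) hB]
  · refine (main a ha0 (by linarith)).trans ?_
    gcongr
    nlinarith [sq_nonneg B, hsq _ _ (by positivity) hA]
  · rcases le_total a b with h3 | h3
    · refine (main b hb0 (by linarith)).trans ?_
      gcongr
      nlinarith [sq_nonneg A, hsq _ _ (by positivity) hB]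
    · refine (main a ha0 (by linarith)).trans ?_
      gcongr
      nlinarith [sq_nonneg B, hsq _ _ (by positivity) hA]

/-- The weighted norm of the Fourier coefficients is bounded by the Sobolev norm. -/
theorem wSummable_of_sobolev {v : Torus → ℝ} (h : sobolevENorm s 2 v < ∞) :
    WSummable s (fun k => ‖fc v k‖) ∧
      wnorm s (fun k => ‖fc v k‖) ≤ √(9 ^ s * 3) * (sobolevENorm s 2 v).toReal := by
  have s0 := summable_symb h (β := (0, 0)) (by simp)
  have s1 := summable_symb h (β := (s, 0)) (by simp)
  have s2 := summable_symb h (β := (0, s)) (by simp)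
  have hsum := ((s0.1.add s1.1).add s2.1).mul_left (9 ^ s)
  have hle : ∀ k, (J k ^ s * ‖fc v k‖) ^ 2 ≤ 9 ^ s * ((‖symb (0, 0) k‖ * ‖fc v k‖) ^ 2 +
      (‖symb (s, 0) k‖ * ‖fc v k‖) ^ 2 + (‖symb (0, s) k‖ * ‖fc v k‖) ^ 2) := by
    intro k
    have := mul_le_mul_of_nonneg_right (J_pow_le s k) (sq_nonneg ‖fc v k‖)
    calc _ = (J k ^ s) ^ 2 * ‖fc v k‖ ^ 2 := by ring
      _ ≤ _ := this
      _ = _ := by ring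
  have h1 : WSummable s (fun k => ‖fc v k‖) :=
    Summable.of_nonneg_of_le (fun _ => sq_nonneg _) hle hsum
  refine ⟨h1, ?_⟩
  rw [wnorm, Real.sqrt_le_left (by positivity), mul_pow, Real.sq_sqrt (by positivity)]
  refine (h1.tsum_le_tsum hle hsum).trans ?_
  rw [tsum_mul_left, (s0.1.add s1.1).tsum_add s2.1, s0.1.tsum_add s1.1, mul_assoc]
  refine mul_le_mul_of_nonneg_left ?_ (by positivity)
  have t0 := sqrt_symb_le h (β := (0, 0)) (by simp)
  have t1 := sqrt_symb_le h (β := (s, 0)) (by simp)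
  have t2 := sqrt_symb_le h (β := (0, s)) (by simp)
  linarith

/-- The Sobolev norm, when finite, is bounded by the weighted norm of the Fourier coefficients. -/
theorem sobolevENorm_le {v : Torus → ℝ} (h : sobolevENorm s 2 v < ∞) {R : ℝ}
    (hR : wnorm s (fun k => ‖fc v k‖) ≤ R) :
    sobolevENorm s 2 v ≤ ∑ m ∈ Finset.range (s + 1),
      ∑ _ ∈ Finset.HasAntidiagonal.antidiagonal m, ENNReal.ofReal ((2 * Real.pi) ^ s * R) := by
  refine Finset.sum_le_sum fun m hm => Finset.sum_le_sum fun β hβ => ?_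
  rw [Finset.HasAntidiagonal.mem_antidiagonal] at hβ
  have hβs : β.1 + β.2 ≤ s := hβ.trans_le (Nat.lt_succ_iff.1 (Finset.mem_range.1 hm))
  -- Finiteness of the Sobolev norm supplies the weak derivatives, so none has to be constructed
  -- from the decay of the coefficients.
  have hs := summable_symb h hβs
  have hw := (wSummable_of_sobolev h).1
  rw [hs.2]
  refine ENNReal.ofReal_le_ofReal ?_
  have hπ := Real.pi_pos
  refine le_trans ?_ (mul_le_mul_of_nonneg_left hR (by positivity))
  have hle : ∀ k, (‖symb β k‖ * ‖fc v k‖) ^ 2 ≤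
      ((2 * Real.pi) ^ s) ^ 2 * (J k ^ s * ‖fc v k‖) ^ 2 := by
    intro k
    rw [← mul_pow, ← mul_assoc]
    have := norm_symb_le hβs k
    gcongr
  rw [Real.sqrt_le_left (mul_nonneg (by positivity) (wnorm_nonneg _ _)), mul_pow, wnorm_sq,
    ← tsum_mul_left]
  exact hs.1.tsum_le_tsum hle (hw.mul_left _)

theorem wnorm_le_add {x y z : Freq → ℝ} (hx0 : ∀ k, 0 ≤ x k) (hy0 : ∀ k, 0 ≤ y k)
    (hz0 : ∀ k, 0 ≤ z k) (hy : WSummable s y) (hz : WSummable s z) (h : ∀ k, x k ≤ y k + z k) :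
    wnorm s x ≤ wnorm s y + wnorm s z := by
  have hJ := fun k => pow_nonneg (J_pos k).le s
  have := Real.Lp_add_le_tsum_of_nonneg (p := 2) one_le_two
    (fun k => mul_nonneg (hJ k) (hy0 k)) (fun k => mul_nonneg (hJ k) (hz0 k))
    (by simpa [WSummable] using hy) (by simpa [WSummable] using hz)
  simp only [Real.rpow_two, ← Real.sqrt_eq_rpow] at this
  have hle : ∀ k, (J k ^ s * x k) ^ 2 ≤ (J k ^ s * y k + J k ^ s * z k) ^ 2 := fun k => by
    refine pow_le_pow_left₀ (mul_nonneg (hJ k) (hx0 k)) ?_ 2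
    rw [← mul_add]
    exact mul_le_mul_of_nonneg_left (h k) (hJ k)
  exact (Real.sqrt_le_sqrt ((Summable.of_nonneg_of_le (fun _ => sq_nonneg _) hle
    this.1).tsum_le_tsum hle this.1)).trans this.2

theorem ContSobolev.wSummable {w : ℝ → L2} {T : ℝ} (h : ContSobolev s w T) {t : ℝ}
    (ht : t ∈ Set.Icc 0 T) : WSummable s fun k => ‖fc (w t) k‖ :=
  (wSummable_of_sobolev (h t ht).1).1

theorem ContSobolev.continuousOn_wnorm {w : ℝ → L2} {T : ℝ} (h : ContSobolev s w T) :
    ContinuousOn (fun t => wnorm s fun k => ‖fc (w t) k‖) (Set.Icc 0 T) := by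
  intro t ht
  have hlim := (h t ht).2
  have hfin : ∀ᶠ r in 𝓝[Set.Icc 0 T] t, sobolevENorm s 2 ((w r - w t : L2) : Torus → ℝ) < ∞ :=
    hlim.eventually (gt_mem_nhds (by simp))
  have hreal := (ENNReal.tendsto_toReal (by simp)).comp hlim
  have hC := hreal.const_mul (√(9 ^ s * 3))
  simp only [ENNReal.toReal_zero, mul_zero, Function.comp_def] at hC
  rw [ContinuousWithinAt, tendsto_iff_dist_tendsto_zero]
  refine squeeze_zero' (Eventually.of_forall fun _ => dist_nonneg) ?_ hC
  filter_upwards [hfin, self_mem_nhdsWithin] with r hr hrT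
  have hd := wSummable_of_sobolev hr
  refine le_trans ?_ hd.2
  have n0 : ∀ (v : L2) k, 0 ≤ ‖fc v k‖ := fun v k => norm_nonneg _
  have h1 := wnorm_le_add (n0 (w r)) (n0 (w t)) (n0 (w r - w t)) (h.wSummable ht) hd.1 fun k => by
    rw [fc_L2_sub]; exact norm_le_insert' _ _
  have h2 := wnorm_le_add (n0 (w t)) (n0 (w r)) (n0 (w r - w t)) (h.wSummable hrT) hd.1 fun k => by
    rw [fc_L2_sub]; exact norm_le_insert _ _
  rw [Real.dist_eq, abs_sub_le_iff]
  constructor <;> linarith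

end Sobolev

theorem isSolenoidal_of_weakDiv {u : Fin 2 → L2} (h : IsWeakDiv (fun i => u i) fun _ => 0) :
    IsSolenoidal (vfc u) := by
  refine ⟨fun k => ?_, fun i k => fc_neg _ k⟩
  have h1 := fc_weakDiv h k
  have h2 : fc (fun _ => 0) k = 0 := by simp [fc, cfc]
  rw [h2, eq_comm, mul_eq_zero] at h1
  have h3 := h1.resolve_left (by simp [Real.pi_ne_zero])
  rw [← h3, dotf, vfc, vfc]
  ring

/-- The Fourier coefficients of `div (b u)`. -/
theorem fc_weakDiv_mul {u : Fin 2 → L2} (hu : IsSolenoidal (vfc u)) {b F : Torus → ℝ}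
    (hb : MemLp b 2) (h : IsWeakDiv (fun i x => b x * u i x) F) (m : Freq) :
    fc F m = transport (vfc u) (fc b) m := by
  have hs : ∀ i, HasSum (fun l => fc (u i) (m - l) * fc b l) (fc (fun x => b x * u i x) m) := by
    intro i
    have := hasSum_fc_mul (memLp_L2 (u i)) hb m
    simpa only [mul_comm (b _)] using this
  have h1 := ((hs 0).mul_left (m 0 : ℂ)).add ((hs 1).mul_left (m 1 : ℂ))
  rw [fc_weakDiv h m, ← h1.tsum_eq, transport]
  congr 1
  refine tsum_congr fun l => ?_
  rw [hu.dotf_sub, dotf, vfc, vfc]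
  ring

/-! ### Growth of the W^{1,2} energy and the supremum of `∇u` -/

section Gradient

variable {u : Fin 2 → Freq → ℂ} {b : Freq → ℂ}

/-- The terms of `∫ ∂_j u_i ∂_i b ∂_j b`. -/
noncomputable def gradTerm (u : Fin 2 → Freq → ℂ) (b : Freq → ℂ) (i j : Fin 2)
    (p : Freq × Freq) : ℂ :=
  starRingEnd ℂ (2 * Real.pi * Complex.I * p.1 j * b p.1) *
    ((2 * Real.pi * Complex.I * ((p.1 - p.2) j : ℤ) * u i (p.1 - p.2)) *
      (2 * Real.pi * Complex.I * p.2 i * b p.2))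

theorem summable_gradTerm (hU : WSummable 3 (amp u)) (hb : WSummable 1 fun k => ‖b k‖)
    (i j : Fin 2) : Summable (gradTerm u b i j) := by
  have n0 : ∀ k, 0 ≤ ‖b k‖ := fun k => norm_nonneg _
  have h := (young_one_weighted (amp_nonneg u) n0 n0 1 le_rfl hU hb hb).1.mul_left
    ((2 * Real.pi) ^ 3)
  refine Summable.of_norm_bounded h fun p => ?_
  have hu : ‖u i (p.1 - p.2)‖ ≤ amp u (p.1 - p.2) := by
    unfold amp
    fin_cases i <;> simp
  have h1 := abs_le_J p.1 j
  have h2 := abs_le_J (p.1 - p.2) j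
  have h3 := abs_le_J p.2 i
  have hJ := J_pos (p.1 - p.2)
  have hJ' := J_pos p.1
  have ha := amp_nonneg u (p.1 - p.2)
  have hπ := Real.pi_pos
  simp only [gradTerm, norm_mul, RCLike.norm_conj, Complex.norm_intCast, Complex.norm_real,
    Complex.norm_I, Real.norm_of_nonneg hπ.le, Complex.norm_ofNat, pow_one, mul_one]
  calc _ ≤ 2 * Real.pi * J p.1 * ‖b p.1‖ * (2 * Real.pi * J (p.1 - p.2) * amp u (p.1 - p.2) *
        (2 * Real.pi * J p.2 * ‖b p.2‖)) := by gcongr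
    _ = _ := by ring

/-- The scalar product of two frequencies. -/
noncomputable def fdot (m k : Freq) : ℝ := (m 0 : ℝ) * k 0 + (m 1 : ℝ) * k 1

/-- Contracting `i` gives the transport symbol of `u`; contracting `j` pairs the derivative on the
test factor with the derivative on `u`, giving `m · (m - l)`. -/
theorem sum_gradTerm (p : Freq × Freq) :
    ∑ i, ∑ j, gradTerm u b i j p =
      ((2 * Real.pi) ^ 3 * fdot p.1 (p.1 - p.2) : ℝ) * pairing u b b p := by
  have hI : Complex.I ^ 3 = -Complex.I := Complex.I_pow_three
  simp only [Fin.sum_univ_two, gradTerm, pairing, fdot, dotf, map_mul, Complex.conj_I,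
    Complex.conj_ofReal, map_ofNat, Pi.sub_apply, map_intCast]
  push_cast
  ring_nf
  simp only [hI]
  ring

/-- Write `1 + |m|² = (1 + m · l) + m · (m - l)`. The first part is symmetric in `m` and `l` and
drops out by antisymmetry; the second is the Fourier side of `∫ ∂_j u_i ∂_i b ∂_j b`. This exact
identity, unlike the `ℓ¹` bounds, allows a return to physical space, where the sup norm of `∇u` is
available. -/
theorem IsSolenoidal.gradient_energy (hu : IsSolenoidal u) (hU : WSummable 3 (amp u))
    (hb : WSummable 3 fun k => ‖b k‖) :
    (2 * Real.pi) ^ 2 * ∑' m, (1 + freqSq m) * (starRingEnd ℂ (b m) * transport u b m).re =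
      (∑ i, ∑ j, ∑' p, gradTerm u b i j p).re := by
  have hb1 := hb.mono (show 1 ≤ 3 by norm_num)
  have hb2 := hb.mono (show 2 ≤ 3 by norm_num)
  have hs := summable_pairing (x := b) (y := b) (φ := fun m => 1 + freqSq m) hU hb1
    (summable_bounded_weight (M := 1) (s := 2) (fun k => by
      rw [abs_of_nonneg (by have := freqSq_nonneg k; positivity), one_mul]
      exact one_add_freqSq_le k) hb2)
  have hg := fun i j => summable_gradTerm hU hb1 i j
  have hgsum : HasSum (fun p => ((2 * Real.pi) ^ 3 * fdot p.1 (p.1 - p.2) : ℝ) * pairing u b b p)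
      (∑ i, ∑ j, ∑' p, gradTerm u b i j p) := by
    simp only [← sum_gradTerm]
    exact hasSum_sum fun i _ => hasSum_sum fun j _ => (hg i j).hasSum
  have hre := Complex.hasSum_re hgsum
  simp only [Complex.re_ofReal_mul] at hre
  have hπ : (2 * Real.pi) ^ 3 ≠ 0 := by have := Real.pi_pos; positivity
  have hfd : HasSum (fun p : Freq × Freq => fdot p.1 (p.1 - p.2) * (pairing u b b p).re)
      (((2 * Real.pi) ^ 3)⁻¹ * (∑ i, ∑ j, ∑' p, gradTerm u b i j p).re) := by
    refine (hre.mul_left ((2 * Real.pi) ^ 3)⁻¹).congr_fun fun p => ?_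
    field_simp
  have hφ : Summable fun p : Freq × Freq => (1 + freqSq p.1) * (pairing u b b p).re := by
    simpa using (Complex.hasSum_re hs.hasSum).summable
  have hanti : ∑' p : Freq × Freq, (1 + fdot p.1 p.2) * (pairing u b b p).re = 0 := by
    have h := (Equiv.prodComm Freq Freq).tsum_eq
      fun p : Freq × Freq => (1 + fdot p.1 p.2) * (pairing u b b p).re
    have e : ∀ p : Freq × Freq, (1 + fdot ((Equiv.prodComm Freq Freq) p).1
        ((Equiv.prodComm Freq Freq) p).2) * (pairing u b b ((Equiv.prodComm Freq Freq) p)).re =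
        -((1 + fdot p.1 p.2) * (pairing u b b p).re) := by
      intro p
      simp only [Equiv.prodComm_apply, hu.pairing_swap, Prod.fst_swap, Prod.snd_swap, fdot]
      ring
    simp only [e, tsum_neg] at h
    linarith
  have hsplit : ∑' p : Freq × Freq, (1 + freqSq p.1) * (pairing u b b p).re =
      ((2 * Real.pi) ^ 3)⁻¹ * (∑ i, ∑ j, ∑' p, gradTerm u b i j p).re := by
    have h1 := hφ.tsum_sub hfd.summable
    rw [hfd.tsum_eq] at h1
    have h2 : ∀ p : Freq × Freq, (1 + freqSq p.1) * (pairing u b b p).re -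
        fdot p.1 (p.1 - p.2) * (pairing u b b p).re =
        (1 + fdot p.1 p.2) * (pairing u b b p).re := by
      intro p
      simp only [freqSq, fdot, Pi.sub_apply]
      push_cast
      ring
    simp only [h2, hanti] at h1
    linarith
  rw [tsum_transport (φ := fun m => 1 + freqSq m) hs, hsplit]
  field_simp

end Gradient

section GradientBound

variable {u : Fin 2 → L2} {b : L2}

/-- Cauchy–Schwarz for the matrix `G` against the rank one matrix of products `β i β j`, whose
Frobenius norm is `|β|²`. -/
theorem abs_quadratic_le (G : Fin 2 → Fin 2 → ℝ) (β : Fin 2 → ℝ) :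
    |∑ i, ∑ j, β j * (G i j * β i)| ≤ √(∑ i, ∑ j, G i j ^ 2) * (β 0 ^ 2 + β 1 ^ 2) := by
  refine abs_le_of_sq_le_sq ?_ (by positivity)
  rw [mul_pow, Real.sq_sqrt (by positivity)]
  have h := Finset.sum_mul_sq_le_sq_mul_sq (Finset.univ : Finset (Fin 2 × Fin 2))
    (fun p => G p.1 p.2) (fun p => β p.1 * β p.2)
  simp only [Fintype.sum_prod_type, Fin.sum_univ_two] at h ⊢
  refine le_trans (le_of_eq ?_) (h.trans (le_of_eq ?_)) <;> ring

/-- The index of the first order derivative `∂_j`. -/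
def unitIdx (j : Fin 2) : ℕ × ℕ := if j = 0 then (1, 0) else (0, 1)

theorem symb_unitIdx (j : Fin 2) (k : Freq) :
    symb (unitIdx j) k = 2 * Real.pi * Complex.I * k j := by
  fin_cases j <;> simp [unitIdx, symb]

/-- The quadratic form of `∇u` is estimated pointwise on the torus, and the resulting `‖∇b‖²` is
turned back into coefficients by Parseval. The factors `(2π)²` on both sides cancel. -/
theorem gradient_bound (hu : IsSolenoidal (vfc u)) (hU : WSummable 3 (amp (vfc u)))
    (hb : sobolevENorm 3 2 b < ∞) {G : Fin 2 → Fin 2 → Torus → ℝ}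
    (hG : ∀ i j, IsWeakDeriv (unitIdx j) (u i) (G i j)) {M : ℝ}
    (hM : ∀ᵐ x, √(∑ i, ∑ j, G i j x ^ 2) ≤ M) :
    |2 * ∑' m, (1 + freqSq m) * (starRingEnd ℂ (fc b m) * transport (vfc u) (fc b) m).re| ≤
      2 * M * ∑' m, (1 + freqSq m) * ‖fc b m‖ ^ 2 := by
  have hM0 : 0 ≤ M := by
    obtain ⟨x, hx⟩ := hM.exists
    exact (Real.sqrt_nonneg _).trans hx
  have hβ : ∀ j, ∃ w, IsWeakDeriv (unitIdx j) b w ∧ MemLp w 2 := fun j =>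
    exists_weakDeriv hb (by fin_cases j <;> simp [unitIdx])
  choose β hβ hβ2 using hβ
  have hGM : ∀ i j, ∀ᵐ x, ‖G i j x‖ ≤ M := by
    intro i j
    filter_upwards [hM] with x hx
    refine le_trans ?_ hx
    rw [Real.norm_eq_abs]
    refine Real.abs_le_sqrt ?_
    exact (Finset.single_le_sum (f := fun j => G i j x ^ 2) (fun _ _ => sq_nonneg _)
      (Finset.mem_univ j)).trans (Finset.single_le_sum (f := fun i => ∑ j, G i j x ^ 2)
      (fun _ _ => Finset.sum_nonneg fun _ _ => sq_nonneg _) (Finset.mem_univ i))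
  have hG2 : ∀ i j, MemLp (G i j) 2 := fun i j =>
    MemLp.of_bound (hG i j).2.1.1 M (hGM i j)
  have hGβ : ∀ i j, MemLp (fun x => G i j x * β i x) 2 := fun i j => by
    refine ((hβ2 i).const_mul M).of_le ((hG i j).2.1.1.mul (hβ2 i).1) ?_
    filter_upwards [hGM i j] with x hx
    rw [norm_mul, norm_mul, Real.norm_of_nonneg hM0]
    gcongr
  have hb3 := (wSummable_of_sobolev hb).1
  have hterm : ∀ i j, ((∫ x, β j x * (G i j x * β i x) : ℝ) : ℂ) =
      ∑' p, gradTerm (vfc u) (fc b) i j p := by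
    intro i j
    have h := hasSum_fc (hβ2 j) (hGβ i j)
    rw [← h.tsum_eq, (summable_gradTerm hU (hb3.mono (by norm_num)) i j).tsum_prod]
    refine tsum_congr fun m => ?_
    rw [← (hasSum_fc_mul (hG2 i j) (hβ2 i) m).tsum_eq, ← tsum_mul_left]
    refine tsum_congr fun l => ?_
    rw [fc_weakDeriv (hβ j), fc_weakDeriv (hβ i), fc_weakDeriv (hG i j), symb_unitIdx,
      symb_unitIdx, symb_unitIdx, gradTerm]
    rfl
  have hint : ∀ i j, Integrable fun x => β j x * (G i j x * β i x) := fun i j =>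
    (hβ2 j).integrable_mul (hGβ i j)
  have hβint : ∀ i, Integrable fun x => β i x ^ 2 := fun i => (hβ2 i).integrable_sq
  have hQ : (∑ i, ∑ j, ∑' p, gradTerm (vfc u) (fc b) i j p).re =
      ∫ x, ∑ i, ∑ j, β j x * (G i j x * β i x) := by
    rw [integral_finsetSum _ fun i _ => integrable_finsetSum _ fun j _ => hint i j]
    simp only [integral_finsetSum _ fun j _ => hint _ j, ← hterm]
    simp
  have hQle : |∫ x, ∑ i, ∑ j, β j x * (G i j x * β i x)| ≤
      ∫ x, M * (β 0 x ^ 2 + β 1 x ^ 2) := by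
    rw [← Real.norm_eq_abs]
    refine norm_integral_le_of_norm_le (((hβint 0).add (hβint 1)).const_mul M) ?_
    filter_upwards [hM] with x hx
    rw [Real.norm_eq_abs]
    refine (abs_quadratic_le (fun i j => G i j x) fun i => β i x).trans ?_
    gcongr
  have hE : HasSum (fun m => (2 * Real.pi) ^ 2 * (freqSq m * ‖fc b m‖ ^ 2))
      (∫ x, (β 0 x ^ 2 + β 1 x ^ 2)) := by
    rw [integral_add (hβint 0) (hβint 1)]
    refine ((hasSum_norm_sq_fc (hβ2 0)).add (hasSum_norm_sq_fc (hβ2 1))).congr_fun fun m => ?_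
    rw [fc_weakDeriv (hβ 0), fc_weakDeriv (hβ 1), symb_unitIdx, symb_unitIdx]
    simp only [norm_mul, Complex.norm_intCast, Complex.norm_real, Complex.norm_I,
      Real.norm_of_nonneg Real.pi_pos.le, Complex.norm_ofNat, mul_one, mul_pow, sq_abs, freqSq]
    ring
  have hid := hu.gradient_energy hU hb3
  rw [hQ] at hid
  have hE' := hE.tsum_eq
  rw [tsum_mul_left] at hE'
  rw [integral_const_mul, ← hE', ← hid, abs_mul, abs_of_pos (by have := Real.pi_pos; positivity),
    mul_left_comm] at hQle
  have h1 := le_of_mul_le_mul_left hQle (by have := Real.pi_pos; positivity)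
  have hsum : Summable fun m => (1 + freqSq m) * ‖fc b m‖ ^ 2 := by
    refine Summable.of_nonneg_of_le (fun m => ?_) (fun m => ?_) (hb3.mono (show 1 ≤ 3 by norm_num))
    · have := freqSq_nonneg m; positivity
    · rw [mul_pow, pow_one]
      exact mul_le_mul_of_nonneg_right (one_add_freqSq_le m) (sq_nonneg _)
  have h2 : ∑' m, freqSq m * ‖fc b m‖ ^ 2 ≤ ∑' m, (1 + freqSq m) * ‖fc b m‖ ^ 2 := by
    have hle : ∀ m, freqSq m * ‖fc b m‖ ^ 2 ≤ (1 + freqSq m) * ‖fc b m‖ ^ 2 := fun m =>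
      mul_le_mul_of_nonneg_right (by linarith) (sq_nonneg _)
    exact (Summable.of_nonneg_of_le (fun m => mul_nonneg (freqSq_nonneg m) (sq_nonneg _)) hle
      hsum).tsum_le_tsum hle hsum
  rw [abs_mul, abs_two, mul_assoc]
  refine mul_le_mul_of_nonneg_left (h1.trans ?_) zero_le_two
  exact mul_le_mul_of_nonneg_left h2 hM0

/-- The growth rate of the `W^{1,2}` energy is controlled by `‖∇u‖_∞`. -/
theorem ofReal_growth_le (hu : IsSolenoidal (vfc u)) (hU : WSummable 3 (amp (vfc u)))
    (hb : sobolevENorm 3 2 b < ∞) {Z : ℝ} (hZ0 : 0 < Z)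
    (hZ : ∑' m, (1 + freqSq m) * ‖fc b m‖ ^ 2 ≤ Z) :
    ENNReal.ofReal
        (|2 * ∑' m, (1 + freqSq m) * (starRingEnd ℂ (fc b m) * transport (vfc u) (fc b) m).re| / Z) ≤
      2 * gradSupENorm u := by
  -- The factor 2 is moved across so that the bound can be proved separately for each candidate
  -- gradient in the infimum.
  rw [← ENNReal.div_le_iff' (by norm_num) (by norm_num)]
  refine le_iInf₂ fun G hG => ?_
  rw [ENNReal.div_le_iff' (by norm_num) (by norm_num)]
  by_cases htop : eLpNorm (fun x => √(∑ i, ∑ j, G i j x ^ 2)) ∞ volume = ∞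
  · rw [htop]; simp
  · set M := (eLpNorm (fun x => √(∑ i, ∑ j, G i j x ^ 2)) ∞ volume).toReal with hMdef
    have hM : ∀ᵐ x, √(∑ i, ∑ j, G i j x ^ 2) ≤ M := by
      have h := ae_le_eLpNormEssSup (f := fun x => √(∑ i, ∑ j, G i j x ^ 2))
        (μ := (volume : Measure Torus))
      rw [← eLpNorm_exponent_top] at h
      filter_upwards [h] with x hx
      rw [Real.enorm_of_nonneg (Real.sqrt_nonneg _)] at hx
      exact (ENNReal.ofReal_le_iff_le_toReal htop).1 hx
    have hb' := gradient_bound hu hU hb (G := G) (fun i j => by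
      fin_cases j
      · exact (hG i).1
      · exact (hG i).2) hM
    have hM0 : 0 ≤ M := ENNReal.toReal_nonneg
    have e : 2 * ENNReal.ofReal M = ENNReal.ofReal (2 * M) := by
      rw [ENNReal.ofReal_mul two_pos.le, ENNReal.ofReal_ofNat]
    rw [← ENNReal.ofReal_toReal htop, ← hMdef, e]
    refine ENNReal.ofReal_le_ofReal ?_
    rw [div_le_iff₀ hZ0]
    exact hb'.trans (mul_le_mul_of_nonneg_left hZ (by positivity))

end GradientBound

/-- Incompressibility replaces `l` by the fixed frequency `m`, so no decay of `x` beyond `ℓ²` is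
needed. -/
theorem summable_dotf {u : Fin 2 → Freq → ℂ} {x : Freq → ℂ} (hu : IsSolenoidal u)
    (hU : WSummable 3 (amp u)) (hx : WSummable 0 fun k => ‖x k‖) (m : Freq) :
    Summable fun l => dotf u (m - l) l * x l := by
  have h0 : Summable fun l => amp u (m - l) ^ 2 := by
    have h := hU.mono (show 0 ≤ 3 by norm_num)
    simp only [WSummable, pow_zero, one_mul] at h
    exact (Equiv.summable_iff (f := fun l => amp u l ^ 2) (Equiv.subLeft m)).2 h
  have h1 := (cauchy_schwarz (fun l => amp_nonneg u (m - l)) (fun l => norm_nonneg (x l)) h0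
    (by simpa [WSummable] using hx)).1.mul_left (J m)
  refine Summable.of_norm_bounded h1 fun l => ?_
  rw [norm_mul, hu.dotf_sub]
  have := norm_dotf_le u (m - l) m
  calc _ ≤ amp u (m - l) * J m * ‖x l‖ := by gcongr
    _ = _ := by ring

theorem transport_sub {u : Fin 2 → Freq → ℂ} {x y : Freq → ℂ} (hu : IsSolenoidal u)
    (hU : WSummable 3 (amp u)) (hx : WSummable 0 fun k => ‖x k‖)
    (hy : WSummable 0 fun k => ‖y k‖) (m : Freq) :
    transport u (fun k => x k - y k) m = transport u x m - transport u y m := by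
  simp only [transport, mul_sub]
  rw [(summable_dotf hu hU hx m).tsum_sub (summable_dotf hu hU hy m), mul_sub]

theorem summable_transport {u : Fin 2 → Freq → ℂ} {x y : Freq → ℂ} {φ : Freq → ℝ}
    (h : Summable fun p : Freq × Freq => (φ p.1 : ℂ) * pairing u x y p) :
    Summable fun m => φ m * (starRingEnd ℂ (y m) * transport u x m).re := by
  have h1 := (Complex.hasSum_re h.prod.hasSum).summable.mul_left (2 * Real.pi)
  refine h1.congr fun m => ?_
  rw [← Complex.re_ofReal_mul, ← Complex.re_ofReal_mul, transport]
  have e : ∀ l, (φ m : ℂ) * pairing u x y (m, l) =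
      (φ m : ℂ) * Complex.I * starRingEnd ℂ (y m) * (dotf u (m - l) l * x l) := fun l => by
    simp only [pairing]; ring
  simp only [e]
  rw [tsum_mul_left]
  congr 1
  push_cast
  ring

/-! ### Energy identities for functions of time given as primitives in L² -/

section TimeEvolution

variable {T : ℝ} {v F : ℝ → L2} {v₀ : L2}

theorem intervalIntegrable_fc (hF : IntervalIntegrable F volume 0 T) (k : Freq) :
    IntervalIntegrable (fun τ => fc (F τ) k) volume 0 T :=
  ⟨(fcCLM k).integrable_comp hF.1, (fcCLM k).integrable_comp hF.2⟩

theorem fc_primitive (hF : IntervalIntegrable F volume 0 T)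
    (hv : ∀ t ∈ Set.Icc 0 T, v t = v₀ - ∫ τ in (0 : ℝ)..t, F τ) (k : Freq) :
    ∀ t ∈ Set.Icc 0 T, fc (v t) k = fc v₀ k - ∫ τ in (0 : ℝ)..t, fc (F τ) k := by
  intro t ht
  have hFt : IntervalIntegrable F volume 0 t := hF.mono_set (by
    rw [Set.uIcc_of_le ht.1, Set.uIcc_of_le (ht.1.trans ht.2)]
    exact Set.Icc_subset_Icc_right ht.2)
  have h := (fcCLM k).intervalIntegral_comp_comm hFt
  simp only [fcCLM_apply] at h
  rw [hv t ht, fc_L2_sub, h]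

theorem initial_value (hT : 0 ≤ T) (hv : ∀ t ∈ Set.Icc 0 T, v t = v₀ - ∫ τ in (0 : ℝ)..t, F τ) :
    v 0 = v₀ := by
  simpa using hv 0 ⟨le_rfl, hT⟩

/-- Energy identity for weighted norms of Sobolev-continuous solutions. -/
theorem energy_identity {s : ℕ} {M : ℝ} {w : Freq → ℝ} (hT : 0 ≤ T) (hM : 0 ≤ M)
    (hF : IntervalIntegrable F volume 0 T)
    (hv : ∀ t ∈ Set.Icc 0 T, v t = v₀ - ∫ τ in (0 : ℝ)..t, F τ)
    (hcont : ContSobolev s v T) (hw0 : ∀ k, 0 ≤ w k) (hw : ∀ k, w k ≤ M * J k ^ s) :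
    IntervalIntegrable
      (fun τ => ∑' k, w k * (starRingEnd ℂ (fc (v τ) k) * fc (F τ) k).re) volume 0 T ∧
    ∀ t ∈ Set.Icc 0 T, ∑' k, w k * ‖fc (v t) k‖ ^ 2 = ∑' k, w k * ‖fc v₀ k‖ ^ 2 -
        2 * ∫ τ in (0 : ℝ)..t, ∑' k, w k * (starRingEnd ℂ (fc (v τ) k) * fc (F τ) k).re := by
  obtain ⟨R, hR⟩ := isCompact_Icc.exists_bound_of_continuousOn hcont.continuousOn_wnorm
  have hle : ∀ (t : ℝ) (k : Freq),
      (w k * ‖fc (v t) k‖) ^ 2 ≤ M ^ 2 * (J k ^ s * ‖fc (v t) k‖) ^ 2 := by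
    intro t k
    rw [← mul_pow, ← mul_assoc]
    exact pow_le_pow_left₀ (mul_nonneg (hw0 k) (norm_nonneg _))
      (mul_le_mul_of_nonneg_right (hw k) (norm_nonneg _)) 2
  have hs : ∀ t ∈ Set.Icc 0 T, Summable fun k => (w k * ‖fc (v t) k‖) ^ 2 := fun t ht =>
    Summable.of_nonneg_of_le (fun _ => sq_nonneg _) (hle t) ((hcont.wSummable ht).mul_left _)
  have hn : ∀ t ∈ Set.Icc 0 T, √(∑' k, (w k * ‖fc (v t) k‖) ^ 2) ≤ M * R := by
    intro t ht
    have h1 := (hs t ht).tsum_le_tsum (hle t) ((hcont.wSummable ht).mul_left _)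
    rw [tsum_mul_left, ← wnorm_sq, ← mul_pow] at h1
    have h2 := Real.sqrt_le_sqrt h1
    rw [Real.sqrt_sq (mul_nonneg hM (wnorm_nonneg _ _))] at h2
    exact h2.trans (mul_le_mul_of_nonneg_left ((le_abs_self _).trans (hR t ht)) hM)
  -- The whole weight falls on `v`, since the time derivative is only known in L². This is why
  -- weights are allowed to grow like `J^s` and not like `J^{2s}`.
  have hcs : ∀ t ∈ Set.Icc 0 T, ∀ g : L2,
      Summable (fun k => w k * (‖fc (v t) k‖ * ‖fc g k‖)) ∧
        ∑' k, w k * (‖fc (v t) k‖ * ‖fc g k‖) ≤ M * R * ‖g‖ := by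
    intro t ht g
    have h := cauchy_schwarz (fun k => mul_nonneg (hw0 k) (norm_nonneg (fc (v t) k)))
      (fun k => norm_nonneg (fc g k)) (hs t ht) (hasSum_norm_sq_L2 g).summable
    rw [(hasSum_norm_sq_L2 g).tsum_eq, Real.sqrt_sq (norm_nonneg _)] at h
    simp only [mul_assoc] at h ⊢
    refine ⟨h.1, h.2.trans ?_⟩
    rw [← mul_assoc M]
    exact mul_le_mul_of_nonneg_right (hn t ht) (norm_nonneg _)
  have h0 : Summable fun k => w k * ‖fc v₀ k‖ ^ 2 := by
    have := (hcs 0 ⟨le_rfl, hT⟩ v₀).1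
    rw [initial_value hT hv] at this
    simpa only [sq] using this
  exact weighted_energy (z := fun k t => fc (v t) k) (F := fun k τ => fc (F τ) k)
    (B := fun τ => M * R * ‖F τ‖) (fun k => intervalIntegrable_fc hF k)
    (fun k => fc_primitive hF hv k) hw0 (hF.norm.const_mul _) (fun t ht => (hcs t ht _).1)
    (fun t ht => (hcs t ht _).2) h0 hT

theorem continuousOn_of_primitive (hT : 0 ≤ T) (hF : IntervalIntegrable F volume 0 T)
    (hv : ∀ t ∈ Set.Icc 0 T, v t = v₀ - ∫ τ in (0 : ℝ)..t, F τ) :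
    ContinuousOn v (Set.Icc 0 T) := by
  have := intervalIntegral.continuousOn_primitive_interval' hF (a := 0) (by simp)
  rw [Set.uIcc_of_le hT] at this
  exact (continuousOn_const.sub this).congr hv

/-- A pointwise bound on the dissipation gives an integral inequality. -/
theorem energy_le_integral {D K : ℝ → ℝ} {e e₀ t : ℝ} (ht : t ∈ Set.Icc 0 T)
    (hD : IntervalIntegrable D volume 0 T) (hK : ContinuousOn K (Set.Icc 0 T))
    (he : e = e₀ - 2 * ∫ τ in (0 : ℝ)..t, D τ) (hle : ∀ τ ∈ Set.Icc 0 T, 2 * |D τ| ≤ K τ) :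
    e ≤ e₀ + ∫ τ in (0 : ℝ)..t, K τ := by
  have hsub : Set.Icc 0 t ⊆ Set.Icc 0 T := Set.Icc_subset_Icc_right ht.2
  have hDt : IntervalIntegrable D volume 0 t := hD.mono_set (by
    rwa [Set.uIcc_of_le ht.1, Set.uIcc_of_le (ht.1.trans ht.2)])
  rw [he, sub_eq_add_neg, ← mul_neg, ← intervalIntegral.integral_neg,
    ← intervalIntegral.integral_const_mul]
  refine add_le_add le_rfl (intervalIntegral.integral_mono_on ht.1 (hDt.neg.const_mul 2)
    ((hK.mono hsub).intervalIntegrable_of_Icc ht.1) fun τ hτ => ?_)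
  exact le_trans (mul_le_mul_of_nonneg_left (neg_le_abs _) zero_le_two) (hle τ (hsub hτ))

/-- Passage to the limit in the truncation level, done on finite sets of frequencies. -/
theorem wnorm_sq_le_of_truncated {s : ℕ} {x : Freq → ℂ} {R : ℝ} (hx : WSummable s fun k => ‖x k‖)
    (h : ∀ N : ℝ, 0 ≤ N → ∑' k, min (J k) N ^ (2 * s) * ‖x k‖ ^ 2 ≤ R) :
    wnorm s (fun k => ‖x k‖) ^ 2 ≤ R := by
  rw [wnorm_sq]
  refine hx.tsum_le_of_sum_le fun S => ?_
  -- This level exceeds every weight on `S`, so the truncation is inactive there.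
  set N := ∑ k ∈ S, J k with hN
  have hN0 : 0 ≤ N := Finset.sum_nonneg fun k _ => (J_pos k).le
  have hm0 : ∀ k, 0 ≤ min (J k) N := fun k => le_min (J_pos k).le hN0
  have hle : ∀ k, min (J k) N ^ (2 * s) * ‖x k‖ ^ 2 ≤ (J k ^ s * ‖x k‖) ^ 2 := fun k => by
    rw [mul_pow, ← pow_mul, mul_comm s 2]
    exact mul_le_mul_of_nonneg_right (pow_le_pow_left₀ (hm0 k) (min_le_left _ _) _) (sq_nonneg _)
  have hnn : ∀ k, 0 ≤ min (J k) N ^ (2 * s) * ‖x k‖ ^ 2 := fun k =>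
    mul_nonneg (pow_nonneg (hm0 k) _) (sq_nonneg _)
  refine le_trans (Finset.sum_le_sum fun k hk => ?_)
    (((Summable.of_nonneg_of_le hnn hle hx).sum_le_tsum S fun k _ => hnn k).trans (h N hN0))
  have hJN : J k ≤ N := Finset.single_le_sum (f := J) (fun k _ => (J_pos k).le) hk
  rw [min_eq_left hJN, mul_pow, ← pow_mul, mul_comm s 2]

theorem truncated_le_wnorm_sq {s : ℕ} {x : Freq → ℂ} (hx : WSummable s fun k => ‖x k‖)
    {N : ℝ} (hN : 0 ≤ N) :
    ∑' k, min (J k) N ^ (2 * s) * ‖x k‖ ^ 2 ≤ wnorm s (fun k => ‖x k‖) ^ 2 := by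
  rw [wnorm_sq]
  have hm0 : ∀ k, 0 ≤ min (J k) N := fun k => le_min (J_pos k).le hN
  have hle : ∀ k, min (J k) N ^ (2 * s) * ‖x k‖ ^ 2 ≤ (J k ^ s * ‖x k‖) ^ 2 := fun k => by
    rw [mul_pow, ← pow_mul, mul_comm s 2]
    exact mul_le_mul_of_nonneg_right (pow_le_pow_left₀ (hm0 k) (min_le_left _ _) _) (sq_nonneg _)
  exact (Summable.of_nonneg_of_le (fun k => mul_nonneg (pow_nonneg (hm0 k) _) (sq_nonneg _)) hle
    hx).tsum_le_tsum hle hx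

end TimeEvolution

theorem wSummable_vfc {s : ℕ} {u : Fin 2 → L2} (hu : ∀ i, sobolevENorm s 2 (u i) < ∞) :
    WSummable s (amp (vfc u)) := by
  have h := fun i => (wSummable_of_sobolev (hu i)).1
  refine Summable.of_nonneg_of_le (fun _ => sq_nonneg _) (fun k => ?_)
    (((h 0).add (h 1)).mul_left 2)
  simp only [amp, vfc, mul_add]
  nlinarith [sq_nonneg (J k ^ s * ‖fc (u 0) k‖ - J k ^ s * ‖fc (u 1) k‖)]

theorem abs_tsum_three_le {φ : Freq → ℝ} {x p q r : Freq → ℂ} {P Q R : ℝ}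
    (hp : Summable fun m => φ m * (starRingEnd ℂ (x m) * p m).re)
    (hq : Summable fun m => φ m * (starRingEnd ℂ (x m) * q m).re)
    (hr : Summable fun m => φ m * (starRingEnd ℂ (x m) * r m).re)
    (hP : |∑' m, φ m * (starRingEnd ℂ (x m) * p m).re| ≤ P)
    (hQ : |∑' m, φ m * (starRingEnd ℂ (x m) * q m).re| ≤ Q)
    (hR : |∑' m, φ m * (starRingEnd ℂ (x m) * r m).re| ≤ R) :
    |∑' m, φ m * (starRingEnd ℂ (x m) * (p m - q m + r m)).re| ≤ P + Q + R := by
  have e : ∀ m, φ m * (starRingEnd ℂ (x m) * (p m - q m + r m)).re =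
      φ m * (starRingEnd ℂ (x m) * p m).re - φ m * (starRingEnd ℂ (x m) * q m).re +
        φ m * (starRingEnd ℂ (x m) * r m).re := fun m => by
    rw [mul_add, mul_sub, Complex.add_re, Complex.sub_re]; ring
  simp only [e]
  rw [(hp.sub hq).tsum_add hr, hp.tsum_sub hq]
  refine (abs_add_le _ _).trans (add_le_add ((abs_sub _ _).trans (add_le_add hP hQ)) hR)

/-! ### Production of vorticity energy -/

section Dissipation

variable {u v : Fin 2 → Freq → ℂ} {x y : Freq → ℂ}

/-- Self-transport contributes nothing, and the two buoyancy terms need only one derivative of `y`.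
Hence a W^{1,2} bound for the buoyancy is enough to control `ω` in L². -/
theorem vorticity_dissipation_zero (hu : IsSolenoidal u) (hU : WSummable 3 (amp u))
    (hV : WSummable 3 (amp v)) (hx : WSummable 2 fun k => ‖x k‖) (hy : WSummable 3 fun k => ‖y k‖) :
    |∑' m, (1 : ℝ) * (starRingEnd ℂ (x m) *
        (transport u x m - transport u y m + transport v y m)).re| ≤
      transConst * (wnorm 3 (amp u) + wnorm 3 (amp v)) * wnorm 0 (fun k => ‖x k‖) *
        wnorm 1 (fun k => ‖y k‖) := by
  have hx0 := hx.mono (show 0 ≤ 2 by norm_num)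
  have hx1 := hx.mono (show 1 ≤ 2 by norm_num)
  have hy1 := hy.mono (show 1 ≤ 3 by norm_num)
  have hφ : Summable fun k => (|(1 : ℝ)| * ‖x k‖) ^ 2 :=
    summable_bounded_weight (φ := fun _ => 1) (M := 1) (s := 0) (fun k => by simp) hx0
  refine (abs_tsum_three_le (φ := fun _ => 1)
    (summable_transport (φ := fun _ => 1) (summable_pairing (φ := fun _ => 1) hU hx1 hφ))
    (summable_transport (φ := fun _ => 1) (summable_pairing (φ := fun _ => 1) hU hy1 hφ))
    (summable_transport (φ := fun _ => 1) (summable_pairing (φ := fun _ => 1) hV hy1 hφ))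
    (P := 0) (by simp only [one_mul, hu.energy_zero hU hx1, abs_zero, le_refl])
    (by simpa using source_zero hU hy1 hx0) (by simpa using source_zero hV hy1 hx0)).trans
    (le_of_eq ?_)
  ring

theorem vorticity_dissipation_four (hu : IsSolenoidal u) (hU : WSummable 3 (amp u))
    (hV : WSummable 3 (amp v)) (hx : WSummable 2 fun k => ‖x k‖) (hy : WSummable 3 fun k => ‖y k‖)
    {N : ℝ} (hN : 0 ≤ N) :
    |∑' m, min (J m) N ^ 4 * (starRingEnd ℂ (x m) *
        (transport u x m - transport u y m + transport v y m)).re| ≤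
      transConst * wnorm 3 (amp u) * wnorm 2 (fun k => ‖x k‖) ^ 2 +
      transConst * wnorm 3 (amp u) * wnorm 2 (fun k => ‖x k‖) * wnorm 3 (fun k => ‖y k‖) +
      transConst * wnorm 3 (amp v) * wnorm 2 (fun k => ‖x k‖) * wnorm 3 (fun k => ‖y k‖) := by
  have hx1 := hx.mono (show 1 ≤ 2 by norm_num)
  have hy1 := hy.mono (show 1 ≤ 3 by norm_num)
  have hφ : Summable fun k => (|min (J k) N ^ 4| * ‖x k‖) ^ 2 :=
    summable_bounded_weight (φ := fun k => min (J k) N ^ 4) (M := N ^ 4) (s := 0)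
      (fun k => by simpa using abs_min_pow_le (J_pos k).le hN 4) (hx.mono (by norm_num))
  exact abs_tsum_three_le (φ := fun k => min (J k) N ^ 4)
    (summable_transport (φ := fun k => min (J k) N ^ 4)
      (summable_pairing (φ := fun k => min (J k) N ^ 4) hU hx1 hφ))
    (summable_transport (φ := fun k => min (J k) N ^ 4)
      (summable_pairing (φ := fun k => min (J k) N ^ 4) hU hy1 hφ))
    (summable_transport (φ := fun k => min (J k) N ^ 4)
      (summable_pairing (φ := fun k => min (J k) N ^ 4) hV hy1 hφ))
    (hu.energy_four hU hx hN) (source_four hU hy hx hN) (source_four hV hy hx hN)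

end Dissipation

/-! ### A priori bounds for local solutions -/

section Solution

variable {α : ℝ} {f : L2} {uh : Fin 2 → L2} {b₀ ω₀ : L2} {b ω : ℝ → L2} {u : ℝ → Fin 2 → L2} {T : ℝ}

/-- The buoyancy equation on the Fourier side. -/
theorem IsLocalSolution.buoyancy (h : IsLocalSolution α f uh b₀ ω₀ b ω u T) :
    ∃ F : ℝ → L2, IntervalIntegrable F volume 0 T ∧
      (∀ t ∈ Set.Icc 0 T, b t = b₀ - ∫ τ in (0 : ℝ)..t, F τ) ∧
      ∀ t ∈ Set.Icc 0 T, ∀ m, fc (F t) m = transport (vfc (u t)) (fc (b t)) m := by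
  obtain ⟨F, hF, hint, heq⟩ := h.eq_b
  exact ⟨F, hint, heq, fun t ht m =>
    fc_weakDiv_mul (h.velocity t ht).isSolenoidal (memLp_L2 _) (hF t ht) m⟩

/-- The vorticity equation on the Fourier side. -/
theorem IsLocalSolution.vorticity (hα : 0 < α) (huh : IsSolenoidal (vfc uh))
    (h : IsLocalSolution α f uh b₀ ω₀ b ω u T) :
    ∃ F : ℝ → L2, IntervalIntegrable F volume 0 T ∧
      (∀ t ∈ Set.Icc 0 T, ω t = ω₀ - ∫ τ in (0 : ℝ)..t, F τ) ∧
      ∀ t ∈ Set.Icc 0 T, ∀ m, fc (F t) m = transport (vfc (u t)) (fc (ω t)) m -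
        transport (vfc (u t)) (fc (b t)) m + transport (vfc uh) (fc (b t)) m := by
  obtain ⟨G, H, hG, hH, hGi, hHi, heq⟩ := h.eq_ω
  refine ⟨fun τ => G τ + H τ, hGi.add hHi, heq, fun t ht m => ?_⟩
  have hv := h.velocity t ht
  rw [fc_L2_add, fc_weakDiv_mul (b := fun x => ω t x - b t x) hv.isSolenoidal
    ((memLp_L2 (ω t)).sub (memLp_L2 (b t))) (hG t ht) m,
    fc_weakDiv_mul huh (memLp_L2 (b t)) (hH t ht) m]
  congr 1
  rw [← transport_sub hv.isSolenoidal (hv.wSummable hα).1 (wSummable_zero _) (wSummable_zero _)]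
  congr 1
  ext k
  exact fc_sub (integrable_L2 _) (integrable_L2 _) k

theorem IsLocalSolution.initial_b (h : IsLocalSolution α f uh b₀ ω₀ b ω u T) : b 0 = b₀ := by
  obtain ⟨F, -, heq, -⟩ := h.buoyancy
  exact initial_value h.pos.le heq

theorem IsLocalSolution.initial_ω (h : IsLocalSolution α f uh b₀ ω₀ b ω u T) : ω 0 = ω₀ := by
  obtain ⟨G, H, -, -, -, -, heq⟩ := h.eq_ω
  exact initial_value h.pos.le heq

/-- The `W^{1,2}` bound for the buoyancy in terms of `∫ ‖∇u‖_∞`. -/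
theorem IsLocalSolution.buoyancy_bound (hα : 0 < α) (h : IsLocalSolution α f uh b₀ ω₀ b ω u T)
    {K : ℝ} (hK : ∫⁻ t in Set.Ioo 0 T, gradSupENorm (u t) ≤ ENNReal.ofReal K) (hK0 : 0 ≤ K)
    {t : ℝ} (ht : t ∈ Set.Icc 0 T) :
    1 + ∑' m, (1 + freqSq m) * ‖fc (b t) m‖ ^ 2 ≤
      (1 + ∑' m, (1 + freqSq m) * ‖fc b₀ m‖ ^ 2) * Real.exp (2 * K) := by
  obtain ⟨F, hF, heq, hfc⟩ := h.buoyancy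
  have hw0 : ∀ k, 0 ≤ 1 + freqSq k := fun k => by have := freqSq_nonneg k; positivity
  obtain ⟨hDi, hE⟩ := energy_identity (s := 3) (M := 1) (w := fun k => 1 + freqSq k) h.pos.le
    zero_le_one hF heq h.cont_b hw0 fun k => by
      rw [one_mul]
      exact (one_add_freqSq_le k).trans (pow_le_pow_right₀ (one_le_J k) (by norm_num))
  set D : ℝ → ℝ := fun τ => ∑' k, (1 + freqSq k) * (starRingEnd ℂ (fc (b τ) k) * fc (F τ) k).re
    with hD
  set e : ℝ → ℝ := fun t => ∑' m, (1 + freqSq m) * ‖fc (b t) m‖ ^ 2 with he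
  set c : ℝ := 1 + ∑' m, (1 + freqSq m) * ‖fc b₀ m‖ ^ 2 with hc
  have he0 : ∀ t, 0 ≤ e t := fun t => tsum_nonneg fun m => mul_nonneg (hw0 m) (sq_nonneg _)
  -- The added 1 keeps the energy in the range where the logarithm is Lipschitz and allows zero
  -- data.
  have hZ : ∀ s ∈ Set.Icc 0 T, 1 + e s = c + ∫ τ in (0 : ℝ)..s, -(2 * D τ) := by
    intro s hs
    rw [he]
    dsimp only
    rw [hE s hs, intervalIntegral.integral_neg, intervalIntegral.integral_const_mul, hc]
    ring
  have hsub : Set.Icc 0 t ⊆ Set.Icc 0 T := Set.Icc_subset_Icc_right ht.2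
  have hDt : IntervalIntegrable (fun τ => -(2 * D τ)) volume 0 t :=
    ((hDi.const_mul 2).neg).mono_set (by
      rwa [Set.uIcc_of_le ht.1, Set.uIcc_of_le h.pos.le])
  have hlog := log_primitive (c := c) ht.1 hDt fun s hs => by
    rw [← hZ s (hsub hs)]; linarith [he0 s]
  rw [← hZ t ht] at hlog
  have hcpos : 0 < c := by
    have : 0 ≤ ∑' m, (1 + freqSq m) * ‖fc b₀ m‖ ^ 2 :=
      tsum_nonneg fun m => mul_nonneg (hw0 m) (sq_nonneg _)
    positivity
  have hcongr : ∫ s in (0 : ℝ)..t, -(2 * D s) / (c + ∫ τ in (0 : ℝ)..s, -(2 * D τ)) =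
      ∫ s in (0 : ℝ)..t, -(2 * D s) / (1 + e s) := by
    refine intervalIntegral.integral_congr fun s hs => ?_
    rw [Set.uIcc_of_le ht.1] at hs
    simp only [← hZ s (hsub hs)]
  have hg : ∀ s ∈ Set.Icc 0 T, ENNReal.ofReal (|2 * D s| / (1 + e s)) ≤ 2 * gradSupENorm (u s) := by
    intro s hs
    have hv := h.velocity s hs
    have := ofReal_growth_le hv.isSolenoidal (hv.wSummable hα).1 (h.cont_b s hs).1
      (Z := 1 + e s) (by linarith [he0 s]) (by linarith)
    simpa only [hD, hfc s hs] using this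
  -- The comparison is made on the logarithmic derivative, so `‖∇u‖_∞` appears only in a lower
  -- integral and its measurability in time is not needed.
  have hbound : ∫ s in (0 : ℝ)..t, -(2 * D s) / (1 + e s) ≤ 2 * K := by
    rw [intervalIntegral.integral_of_le ht.1]
    refine (le_abs_self _).trans ?_
    rw [← Real.norm_eq_abs]
    refine (norm_integral_le_lintegral_norm _).trans ?_
    refine ENNReal.toReal_le_of_le_ofReal (by positivity) ?_
    calc ∫⁻ s in Set.Ioc 0 t, ENNReal.ofReal ‖-(2 * D s) / (1 + e s)‖
        = ∫⁻ s in Set.Ioo 0 t, ENNReal.ofReal ‖-(2 * D s) / (1 + e s)‖ := by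
          rw [restrict_Ioo_eq_restrict_Ioc]
      _ ≤ ∫⁻ s in Set.Ioo 0 t, 2 * gradSupENorm (u s) := by
          refine setLIntegral_mono' measurableSet_Ioo fun s hs => ?_
          have h1 := hg s ⟨hs.1.le, hs.2.le.trans ht.2⟩
          rwa [norm_div, norm_neg, Real.norm_eq_abs,
            Real.norm_of_nonneg (by linarith [he0 s] : 0 ≤ 1 + e s)]
      _ = 2 * ∫⁻ s in Set.Ioo 0 t, gradSupENorm (u s) :=
          lintegral_const_mul' _ _ (by norm_num)
      _ ≤ 2 * ∫⁻ s in Set.Ioo 0 T, gradSupENorm (u s) := by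
          gcongr
          exact ht.2
      _ ≤ 2 * ENNReal.ofReal K := by gcongr
      _ = ENNReal.ofReal (2 * K) := by
          rw [ENNReal.ofReal_mul two_pos.le, ENNReal.ofReal_ofNat]
  rw [hcongr] at hlog
  have hpos : 0 < 1 + e t := by linarith [he0 t]
  change 1 + e t ≤ _
  rw [← Real.exp_log hpos, hlog, Real.exp_add, Real.exp_log hcpos]
  gcongr

/-- The `L²` bound for the vorticity. -/
theorem IsLocalSolution.vorticity_bound (hα : 0 < α) (huh : IsSolenoidal (vfc uh))
    (hUh : WSummable 3 (amp (vfc uh))) (h : IsLocalSolution α f uh b₀ ω₀ b ω u T) {β : ℝ}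
    (hβ : ∀ t ∈ Set.Icc 0 T, wnorm 1 (fun k => ‖fc (b t) k‖) ≤ β) {t : ℝ} (ht : t ∈ Set.Icc 0 T) :
    1 + ‖ω t‖ ^ 2 ≤ (1 + ‖ω₀‖ ^ 2) * Real.exp
      (2 * transConst * β * (ellConst α * (1 + ‖f‖) + wnorm 3 (amp (vfc uh))) * t) := by
  obtain ⟨F, hF, heq, hfc⟩ := h.vorticity hα huh
  obtain ⟨hDi, hE⟩ := energy_identity (s := 2) (M := 1) (w := fun _ => 1) h.pos.le
    zero_le_one hF heq h.cont_ω (fun _ => zero_le_one) fun k => by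
      rw [one_mul]; exact one_le_pow₀ (one_le_J k)
  have hβ0 : 0 ≤ β := (wnorm_nonneg _ _).trans (hβ t ht)
  have hC := transConst_nonneg
  have hA := ellConst_nonneg hα
  have hUh0 := wnorm_nonneg 3 (amp (vfc uh))
  set κ := 2 * transConst * β * (ellConst α * (1 + ‖f‖) + wnorm 3 (amp (vfc uh))) with hκ
  have hκ0 : 0 ≤ κ := by positivity
  have hωc : ContinuousOn (fun t => 1 + ‖ω t‖ ^ 2) (Set.Icc 0 T) :=
    continuousOn_const.add ((continuousOn_of_primitive h.pos.le hF heq).norm.pow 2)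
  have hnorm : ∀ v : L2, ∑' k, (1 : ℝ) * ‖fc v k‖ ^ 2 = ‖v‖ ^ 2 := fun v => by
    simpa using (hasSum_norm_sq_L2 v).tsum_eq
  have hle : ∀ τ ∈ Set.Icc 0 T,
      2 * |∑' k, (1 : ℝ) * (starRingEnd ℂ (fc (ω τ) k) * fc (F τ) k).re| ≤ κ * (1 + ‖ω τ‖ ^ 2) := by
    intro τ hτ
    have hv := h.velocity τ hτ
    have hU := hv.wSummable hα
    have hd := vorticity_dissipation_zero hv.isSolenoidal hU.1 hUh (h.cont_ω.wSummable hτ)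
      (h.cont_b.wSummable hτ)
    simp only [← hfc τ hτ, wnorm_zero_L2] at hd
    have hb := hβ τ hτ
    -- The velocity is affine in `‖ω‖`, so the production is quadratic plus linear; this absorbs the
    -- linear part and closes the Grönwall argument.
    have h1 : ‖ω τ‖ ≤ 1 + ‖ω τ‖ ^ 2 := by nlinarith [sq_nonneg (‖ω τ‖ - 1)]
    have h2 : (ellConst α * (‖ω τ‖ + ‖f‖) + wnorm 3 (amp (vfc uh))) * ‖ω τ‖ ≤
        (ellConst α * (1 + ‖f‖) + wnorm 3 (amp (vfc uh))) * (1 + ‖ω τ‖ ^ 2) := by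
      have i1 := mul_le_mul_of_nonneg_left h1 (mul_nonneg hA (norm_nonneg f))
      have i2 := mul_le_mul_of_nonneg_left h1 hUh0
      nlinarith
    calc _ ≤ 2 * (transConst * (ellConst α * (‖ω τ‖ + ‖f‖) + wnorm 3 (amp (vfc uh))) * ‖ω τ‖ * β) := by
          refine mul_le_mul_of_nonneg_left (hd.trans ?_) zero_le_two
          gcongr
          · exact wnorm_nonneg _ _
          · exact hU.2
      _ = 2 * transConst * β *
          ((ellConst α * (‖ω τ‖ + ‖f‖) + wnorm 3 (amp (vfc uh))) * ‖ω τ‖) := by ring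
      _ ≤ 2 * transConst * β *
          ((ellConst α * (1 + ‖f‖) + wnorm 3 (amp (vfc uh))) * (1 + ‖ω τ‖ ^ 2)) := by gcongr
      _ = _ := by rw [hκ]; ring
  have hsub : Set.Icc 0 t ⊆ Set.Icc 0 T := Set.Icc_subset_Icc_right ht.2
  refine gronwall_integral (Y := fun t => 1 + ‖ω t‖ ^ 2) ht.1 hκ0 (by simp) (hωc.mono hsub)
    (fun s _ => by positivity) fun s hs => ?_
  have := energy_le_integral (K := fun τ => κ * (1 + ‖ω τ‖ ^ 2)) (hsub hs) hDi
    (continuousOn_const.mul hωc) (hE s (hsub hs)) hle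
  rw [hnorm, hnorm] at this
  linarith

/-- Propagation of the top order norms under a bound for the velocity in `W^{3,2}`. -/
theorem IsLocalSolution.top_order_bound (hα : 0 < α) (huh : IsSolenoidal (vfc uh))
    (hUh : WSummable 3 (amp (vfc uh))) (h : IsLocalSolution α f uh b₀ ω₀ b ω u T) {U : ℝ}
    (hU : ∀ t ∈ Set.Icc 0 T, wnorm 3 (amp (vfc (u t))) ≤ U) :
    1 + wnorm 3 (fun k => ‖fc (b T) k‖) ^ 2 + wnorm 2 (fun k => ‖fc (ω T) k‖) ^ 2 ≤
      (1 + wnorm 3 (fun k => ‖fc b₀ k‖) ^ 2 + wnorm 2 (fun k => ‖fc ω₀ k‖) ^ 2) *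
        Real.exp (2 * transConst * (2 * U + wnorm 3 (amp (vfc uh))) * T) := by
  have hT0 : (0 : ℝ) ∈ Set.Icc 0 T := ⟨le_rfl, h.pos.le⟩
  have hU0 : 0 ≤ U := (wnorm_nonneg _ _).trans (hU 0 hT0)
  have hC := transConst_nonneg
  have hUh0 := wnorm_nonneg 3 (amp (vfc uh))
  set B : ℝ → ℝ := fun t => wnorm 3 (fun k => ‖fc (b t) k‖) with hB
  set W : ℝ → ℝ := fun t => wnorm 2 (fun k => ‖fc (ω t) k‖) with hW
  have hBc : ContinuousOn B (Set.Icc 0 T) := h.cont_b.continuousOn_wnorm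
  have hWc : ContinuousOn W (Set.Icc 0 T) := h.cont_ω.continuousOn_wnorm
  have hB0 : ∀ t, 0 ≤ B t := fun t => wnorm_nonneg _ _
  have hW0 : ∀ t, 0 ≤ W t := fun t => wnorm_nonneg _ _
  have hwN : ∀ (N : ℝ), 0 ≤ N → ∀ (n s : ℕ) (k : Freq), min (J k) N ^ n ≤ N ^ n * J k ^ s := by
    intro N hN n s k
    refine (pow_le_pow_left₀ (le_min (J_pos k).le hN) (min_le_right _ _) n).trans ?_
    exact le_mul_of_one_le_right (pow_nonneg hN n) (one_le_pow₀ (one_le_J k))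
  have hm0 : ∀ (N : ℝ), 0 ≤ N → ∀ (n : ℕ) (k : Freq), 0 ≤ min (J k) N ^ n := fun N hN n k =>
    pow_nonneg (le_min (J_pos k).le hN) n
  have hb : ∀ t ∈ Set.Icc 0 T, B t ^ 2 ≤ wnorm 3 (fun k => ‖fc b₀ k‖) ^ 2 +
      ∫ τ in (0 : ℝ)..t, 2 * (transConst * U * B τ ^ 2) := by
    intro t ht
    obtain ⟨F, hF, heq, hfc⟩ := h.buoyancy
    refine wnorm_sq_le_of_truncated (h.cont_b.wSummable ht) fun N hN => ?_
    obtain ⟨hDi, hE⟩ := energy_identity (w := fun k => min (J k) N ^ (2 * 3)) h.pos.le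
      (pow_nonneg hN (2 * 3)) hF heq h.cont_b (hm0 N hN _) (hwN N hN _ _)
    refine (energy_le_integral ht hDi (K := fun τ => 2 * (transConst * U * B τ ^ 2))
      (continuousOn_const.mul (continuousOn_const.mul (hBc.pow 2))) (hE t ht) ?_).trans ?_
    · intro τ hτ
      have hv := h.velocity τ hτ
      have hd := hv.isSolenoidal.energy_six (hv.wSummable hα).1 (h.cont_b.wSummable hτ) hN
      simp only [← hfc τ hτ] at hd
      refine mul_le_mul_of_nonneg_left (hd.trans ?_) zero_le_two
      have := hU τ hτ
      gcongr
    · have := truncated_le_wnorm_sq (h.cont_b.wSummable hT0) hN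
      rw [h.initial_b] at this
      linarith
  have hω : ∀ t ∈ Set.Icc 0 T, W t ^ 2 ≤ wnorm 2 (fun k => ‖fc ω₀ k‖) ^ 2 +
      ∫ τ in (0 : ℝ)..t, 2 * (transConst * U * W τ ^ 2 + transConst * U * W τ * B τ +
        transConst * wnorm 3 (amp (vfc uh)) * W τ * B τ) := by
    intro t ht
    obtain ⟨F, hF, heq, hfc⟩ := h.vorticity hα huh
    refine wnorm_sq_le_of_truncated (h.cont_ω.wSummable ht) fun N hN => ?_
    obtain ⟨hDi, hE⟩ := energy_identity (w := fun k => min (J k) N ^ (2 * 2)) h.pos.le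
      (pow_nonneg hN (2 * 2)) hF heq h.cont_ω (hm0 N hN _) (hwN N hN _ _)
    refine (energy_le_integral ht hDi (K := fun τ => 2 * (transConst * U * W τ ^ 2 +
      transConst * U * W τ * B τ + transConst * wnorm 3 (amp (vfc uh)) * W τ * B τ))
      (by fun_prop) (hE t ht) ?_).trans ?_
    · intro τ hτ
      have hv := h.velocity τ hτ
      have hd := vorticity_dissipation_four hv.isSolenoidal (hv.wSummable hα).1 hUh
        (h.cont_ω.wSummable hτ) (h.cont_b.wSummable hτ) hN
      simp only [← hfc τ hτ] at hd
      refine mul_le_mul_of_nonneg_left (hd.trans ?_) zero_le_two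
      have h1 := hU τ hτ
      have h2 := hB0 τ
      have h3 := hW0 τ
      change transConst * wnorm 3 (amp (vfc (u τ))) * W τ ^ 2 +
        transConst * wnorm 3 (amp (vfc (u τ))) * W τ * B τ +
        transConst * wnorm 3 (amp (vfc uh)) * W τ * B τ ≤ _
      gcongr
    · have := truncated_le_wnorm_sq (h.cont_ω.wSummable hT0) hN
      rw [h.initial_ω] at this
      linarith
  set κ := 2 * transConst * (2 * U + wnorm 3 (amp (vfc uh))) with hκ
  have hκ0 : 0 ≤ κ := by positivity
  refine gronwall_integral (Y := fun t => 1 + B t ^ 2 + W t ^ 2) h.pos.le hκ0 ?_ (by fun_prop)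
    (fun s _ => by positivity) fun t ht => ?_
  · have := sq_nonneg (wnorm 3 fun k => ‖fc b₀ k‖)
    have := sq_nonneg (wnorm 2 fun k => ‖fc ω₀ k‖)
    linarith
  · have hsub : Set.Icc 0 t ⊆ Set.Icc 0 T := Set.Icc_subset_Icc_right ht.2
    have hBt := hBc.mono hsub
    have hWt := hWc.mono hsub
    have i1 : IntervalIntegrable (fun τ => 2 * (transConst * U * B τ ^ 2)) volume 0 t :=
      ContinuousOn.intervalIntegrable_of_Icc ht.1 (by fun_prop)
    have i2 : IntervalIntegrable (fun τ => 2 * (transConst * U * W τ ^ 2 +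
        transConst * U * W τ * B τ + transConst * wnorm 3 (amp (vfc uh)) * W τ * B τ)) volume 0 t :=
      ContinuousOn.intervalIntegrable_of_Icc ht.1 (by fun_prop)
    have i3 : IntervalIntegrable (fun τ => κ * (1 + B τ ^ 2 + W τ ^ 2)) volume 0 t :=
      ContinuousOn.intervalIntegrable_of_Icc ht.1 (by fun_prop)
    have hmono := intervalIntegral.integral_mono_on ht.1 (i1.add i2) i3 fun τ _ => by
      -- Decouples the mixed terms. The self-transport and the mixed term each contribute one `U`,
      -- and `uh` contributes its own norm, which gives `2 U + wnorm 3 (amp (vfc uh))`.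
      have hWB : W τ * B τ ≤ B τ ^ 2 + W τ ^ 2 := by nlinarith [sq_nonneg (W τ - B τ), hB0 τ, hW0 τ]
      have j1 := mul_le_mul_of_nonneg_left hWB (mul_nonneg hC hU0)
      have j2 := mul_le_mul_of_nonneg_left hWB (mul_nonneg hC hUh0)
      have j3 : 0 ≤ transConst * U := mul_nonneg hC hU0
      have j4 : 0 ≤ transConst * wnorm 3 (amp (vfc uh)) := mul_nonneg hC hUh0
      rw [hκ]
      nlinarith
    rw [intervalIntegral.integral_add i1 i2] at hmono
    have := hb t ht
    have := hω t ht
    linarith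

end Solution

theorem wnorm_one_sq_le (v : L2) (hv : sobolevENorm 3 2 v < ∞) :
    wnorm 1 (fun k => ‖fc v k‖) ^ 2 ≤ 3 * ∑' m, (1 + freqSq m) * ‖fc v m‖ ^ 2 := by
  have h1 := (wSummable_of_sobolev hv).1.mono (show 1 ≤ 3 by norm_num)
  have hsum : Summable fun m => (1 + freqSq m) * ‖fc v m‖ ^ 2 := by
    refine Summable.of_nonneg_of_le (fun m => ?_) (fun m => ?_) h1
    · have := freqSq_nonneg m; positivity
    · rw [mul_pow, pow_one]
      exact mul_le_mul_of_nonneg_right (one_add_freqSq_le m) (sq_nonneg _)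
  rw [wnorm_sq, ← tsum_mul_left]
  refine h1.tsum_le_tsum (fun m => ?_) (hsum.mul_left 3)
  rw [mul_pow, pow_one, ← mul_assoc]
  exact mul_le_mul_of_nonneg_right (J_sq_le m) (sq_nonneg _)

end TQG

/-! ### The blow-up criterion -/

theorem mainTheorem8 (α : ℝ) (hα : 0 < α)
    (uh : Fin 2 → TQG.L2)
    (huh : ∀ i, TQG.sobolevENorm 3 2 (uh i) < ∞)
    (huh_div : TQG.IsWeakDiv (fun i => uh i) (fun _ => 0))
    (f : TQG.L2) (hf : TQG.sobolevENorm 2 2 f < ∞)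
    (b₀ ω₀ : TQG.L2) (hb₀ : TQG.sobolevENorm 3 2 b₀ < ∞) (hω₀ : TQG.sobolevENorm 2 2 ω₀ < ∞)
    (b ω : ℝ → TQG.L2) (u : ℝ → Fin 2 → TQG.L2) (Tmax : EReal)
    (hmax : TQG.IsMaximalSolution α f uh b₀ ω₀ b ω u Tmax)
    (hfin : Tmax < ⊤) :
    ∫⁻ t in {t : ℝ | 0 < t ∧ (t : EReal) < Tmax}, TQG.gradSupENorm (u t) = ∞ := by
  open TQG in
  obtain ⟨hpos, T, hmono, hlim, hsol, hblow⟩ := hmax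
  replace hblow := hblow hfin
  by_contra hne
  lift Tmax to ℝ using ⟨hfin.ne, (lt_of_le_of_lt bot_le hpos).ne'⟩
  have hTle : ∀ n, T n ≤ Tmax := fun n => EReal.coe_le_coe_iff.1
    (Monotone.ge_of_tendsto (f := fun n => (T n : EReal))
      (fun i j hij => EReal.coe_le_coe_iff.2 (hmono hij)) hlim n)
  set K := (∫⁻ t in {t : ℝ | 0 < t ∧ (t : EReal) < Tmax}, gradSupENorm (u t)).toReal with hK
  have hK0 : 0 ≤ K := ENNReal.toReal_nonneg
  have hKle : ∀ n, ∫⁻ t in Set.Ioo 0 (T n), gradSupENorm (u t) ≤ ENNReal.ofReal K := by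
    intro n
    rw [hK, ENNReal.ofReal_toReal hne]
    exact lintegral_mono_set fun t ht =>
      ⟨ht.1, EReal.coe_lt_coe_iff.2 (ht.2.trans_le (hTle n))⟩
  have hsolh := isSolenoidal_of_weakDiv huh_div
  have hUh := wSummable_vfc huh
  have hC := transConst_nonneg
  have hA := ellConst_nonneg hα
  have hUh0 := wnorm_nonneg 3 (amp (vfc uh))
  -- The factor 3 comes from comparing `J²` with `1 + |k|²` in `wnorm_one_sq_le`.
  set β := √(3 * ((1 + ∑' m, (1 + freqSq m) * ‖fc b₀ m‖ ^ 2) * Real.exp (2 * K))) with hβ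
  have hβ0 : 0 ≤ β := Real.sqrt_nonneg _
  have hb1 : ∀ n, ∀ t ∈ Set.Icc 0 (T n), wnorm 1 (fun k => ‖fc (b t) k‖) ≤ β := by
    intro n t ht
    have h1 := (hsol n).buoyancy_bound hα (hKle n) hK0 ht
    refine Real.le_sqrt_of_sq_le ((wnorm_one_sq_le _ ((hsol n).cont_b t ht).1).trans ?_)
    linarith
  set κ := 2 * transConst * β * (ellConst α * (1 + ‖f‖) + wnorm 3 (amp (vfc uh))) with hκ
  have hκ0 : 0 ≤ κ := by positivity
  -- From here on `T n` is replaced by `Tmax` in the exponents, so that every bound is independent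
  -- of `n`.
  set Ω := (1 + ‖ω₀‖ ^ 2) * Real.exp (κ * Tmax) with hΩ
  have hω1 : ∀ n, ∀ t ∈ Set.Icc 0 (T n), ‖ω t‖ ≤ Ω := by
    intro n t ht
    have h1 := (hsol n).vorticity_bound hα hsolh hUh (hb1 n) ht
    have h2 : (1 + ‖ω₀‖ ^ 2) * Real.exp (κ * t) ≤ Ω := by
      have := ht.2.trans (hTle n)
      rw [hΩ]
      gcongr
    nlinarith [sq_nonneg (‖ω t‖ - 1)]
  set U := ellConst α * (Ω + ‖f‖) with hUdef
  have hU : ∀ n, ∀ t ∈ Set.Icc 0 (T n), wnorm 3 (amp (vfc (u t))) ≤ U := by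
    intro n t ht
    refine (((hsol n).velocity t ht).wSummable hα).2.trans ?_
    have := hω1 n t ht
    rw [hUdef]
    gcongr
  have hU0 : 0 ≤ U := by
    have : 0 ≤ Ω := by positivity
    positivity
  set R := (1 + wnorm 3 (fun k => ‖fc b₀ k‖) ^ 2 + wnorm 2 (fun k => ‖fc ω₀ k‖) ^ 2) *
    Real.exp (2 * transConst * (2 * U + wnorm 3 (amp (vfc uh))) * Tmax) with hR
  have hfinal : ∀ n, wnorm 3 (fun k => ‖fc (b (T n)) k‖) ≤ R ∧
      wnorm 2 (fun k => ‖fc (ω (T n)) k‖) ≤ R := by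
    intro n
    have h1 := (hsol n).top_order_bound hα hsolh hUh (hU n)
    have h2 : (1 + wnorm 3 (fun k => ‖fc b₀ k‖) ^ 2 + wnorm 2 (fun k => ‖fc ω₀ k‖) ^ 2) *
        Real.exp (2 * transConst * (2 * U + wnorm 3 (amp (vfc uh))) * T n) ≤ R := by
      have := hTle n
      rw [hR]
      gcongr
    -- `R` bounds `1 + x²` and hence `x`, for each of the two norms.
    constructor
    · nlinarith [sq_nonneg (wnorm 3 (fun k => ‖fc (b (T n)) k‖) - 1),
        sq_nonneg (wnorm 2 fun k => ‖fc (ω (T n)) k‖)]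
    · nlinarith [sq_nonneg (wnorm 2 (fun k => ‖fc (ω (T n)) k‖) - 1),
        sq_nonneg (wnorm 3 fun k => ‖fc (b (T n)) k‖)]
  obtain ⟨c, hc, hcle⟩ : ∃ c : ℝ≥0∞, c < ∞ ∧ ∀ n, normM (b (T n)) (ω (T n)) ≤ c := by
    refine ⟨(∑ m ∈ Finset.range (3 + 1), ∑ _ ∈ Finset.HasAntidiagonal.antidiagonal m,
      ENNReal.ofReal ((2 * Real.pi) ^ 3 * R)) + ∑ m ∈ Finset.range (2 + 1),
      ∑ _ ∈ Finset.HasAntidiagonal.antidiagonal m, ENNReal.ofReal ((2 * Real.pi) ^ 2 * R),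
      ENNReal.add_lt_top.2 ⟨?_, ?_⟩, fun n => ?_⟩
    · exact ENNReal.sum_lt_top.2 fun _ _ => ENNReal.sum_lt_top.2 fun _ _ => ENNReal.ofReal_lt_top
    · exact ENNReal.sum_lt_top.2 fun _ _ => ENNReal.sum_lt_top.2 fun _ _ => ENNReal.ofReal_lt_top
    · have hTn : T n ∈ Set.Icc 0 (T n) := ⟨(hsol n).pos.le, le_rfl⟩
      exact add_le_add (sobolevENorm_le ((hsol n).cont_b _ hTn).1 (hfinal n).1)
        (sobolevENorm_le ((hsol n).cont_ω _ hTn).1 (hfinal n).2)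
  have hlimsup : limsup (fun n => normM (b (T n)) (ω (T n)) ^ 2) atTop ≤ c ^ 2 :=
    limsup_le_of_le (h := Eventually.of_forall fun n => pow_le_pow_left' (hcle n) 2)
  rw [hblow, top_le_iff] at hlimsup
  exact (ENNReal.pow_lt_top hc).ne hlimsup
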